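/- Let $H=(V,E(H))$ be a finite connected simple graph with real edge costs $c'_e\ge 0$, and let $s\neq t$ be two vertices of $H$. Let $G=(V,E)$ be the metric completion of $H$, i.e. the complete graph on $V$ in which the cost $c_{uv}$ of an edge $uv$ is the minimum $c'$-cost of a $u$-$v$ path in $H$. For a set $S$ of vertices, $\delta(S)$ is the set of edges (of the graph in question) with exactly one end in $S$; for a partition $\mathcal W$ of $V$ into nonempty parts, $\delta(\mathcal W)=\bigcup_{W\in\mathcal W}\delta(W)$; and $x(D)=\sum_{e\in D}x_e$. Let (L.P.1) be the problem of minimizing $\sum_{e\in E}c_ex_e$ over $x\in\mathbb R^{E}$ subject to - $x(\delta(\{s\}))=x(\delta(\{t\}))=1$, and $x(\delta(\{v\}))=2$ for all $v\ne s,t$; - $x(\delta(S))\ge 1$ for all $\emptyset\subsetneq S\subsetneq V$ with $|S\cap\{s,t\}|=1$; - $x(\delta(S))\ge 2$ for all $\emptyset\subsetneq S\subsetneq V$ with $|S\cap\{s,t\}|$ even; - $0\le x_e\le 1$ for all $e\in E$. Let (L.P.4) be the problem of minimizing $\sum_{e\in E(H)}c'_ex_e$ over $x\in\mathbb R^{E(H)}$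 subject to - $x(\delta(\mathcal W))\ge|\mathcal W|-1$ for all partitions $\mathcal W$ of $V$; - $x(\delta(S))\ge 2$ for all $\emptyset\subsetneq S\subsetneq V$ with $|S\cap\{s,t\}|$ even; - $x_e\ge 0$ for all $e\in E(H)$. For $k=1,4$ let $Opt_{int}(LP_k)$ be the minimum cost of a feasible solution of (L.P.$k$) all of whose entries are integers. Then both minima exist and $$Opt_{int}(LP_4)\le Opt_{int}(LP_1)\le \tfrac32\,Opt_{int}(LP_4).$$ Moreover, both bounds are tight, already for unit costs $c'\equiv 1$: for every $n\ge 2$ there are such a connected graph $H$ on $n$ vertices and $s\ne t$ with $Opt_{int}(LP_4)=Opt_{int}(LP_1)>0$; and for every $\varepsilon>0$ there are such a connected graph $H$ and $s\ne t$ with $Opt_{int}(LP_4)>0$ and $Opt_{int}(LP_1)>(\tfrac32-\varepsilon)\,Opt_{int}(LP_4)$. -/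

import Mathlib

namespace PathTSP

/-- The set `δ(S)` of edges of `G` with exactly one end in `S`. -/
noncomputable def delta {V : Type*} [Fintype V] (G : SimpleGraph V) (S : Finset V) :
    Finset G.edgeSet :=
  (Set.toFinite {e : G.edgeSet | ∃ u ∈ S, ∃ v ∉ S, (e : Sym2 V) = s(u, v)}).toFinset

/-- The union `δ(𝒲)` of the sets `δ(W)` over the parts `W` of a partition `𝒲` of the vertices. -/
noncomputable def deltaPartition {V : Type*} [Fintype V] [DecidableEq V] (G : SimpleGraph V)
    (𝒲 : Finpartition (Finset.univ : Finset V)) : Finset G.edgeSet :=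
  (Set.toFinite {e : G.edgeSet | ∃ W ∈ 𝒲.parts, e ∈ delta G W}).toFinset

/-- The cost of an edge vector `x` for the edge costs `c` (used for finite graphs). -/
noncomputable def cost {V : Type*} {G : SimpleGraph V} (c x : G.edgeSet → ℝ) : ℝ :=
  ∑ᶠ e : G.edgeSet, c e * x e

/-- All entries of the edge vector are integers. -/
def IsIntegral {V : Type*} {G : SimpleGraph V} (x : G.edgeSet → ℝ) : Prop :=
  ∀ e, ∃ k : ℤ, x e = k

/-- The cost of a walk, where each edge is counted as often as it is traversed. -/
def walkCost {V : Type*} {H : SimpleGraph V} (c' : H.edgeSet → ℝ) {u v : V}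
    (p : H.Walk u v) : ℝ :=
  (p.darts.map fun d => c' ⟨d.edge, d.edge_mem⟩).sum

/-- The shortest-path distance in `H` with respect to the edge costs `c'`. -/
noncomputable def shortestDist {V : Type*} {H : SimpleGraph V} (c' : H.edgeSet → ℝ)
    (u v : V) : ℝ :=
  ⨅ p : H.Walk u v, walkCost c' p

theorem walkCost_reverse {V : Type*} {H : SimpleGraph V} (c' : H.edgeSet → ℝ) {u v : V}
    (p : H.Walk u v) : walkCost c' p.reverse = walkCost c' p := by
  unfold walkCost
  rw [SimpleGraph.Walk.darts_reverse, List.map_reverse, List.sum_reverse, List.map_map]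
  congr 1
  apply List.map_congr_left
  intro d _
  simp [SimpleGraph.Dart.edge_symm]

theorem shortestDist_comm {V : Type*} {H : SimpleGraph V} (c' : H.edgeSet → ℝ) (u v : V) :
    shortestDist c' u v = shortestDist c' v u := by
  unfold shortestDist
  refine Function.Surjective.iInf_congr SimpleGraph.Walk.reverse ?_ ?_
  · intro p
    exact ⟨p.reverse, p.reverse_reverse⟩
  · intro p
    exact walkCost_reverse c' p

/-- The cost function of the metric completion of `H`: the complete graph on the vertices of `H`,
an edge `uv` having as cost the cost of a shortest `u`-`v` path in `H`. -/
noncomputable def metricCost {V : Type*} {H : SimpleGraph V} (c' : H.edgeSet → ℝ) :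
    (⊤ : SimpleGraph V).edgeSet → ℝ :=
  fun e => Sym2.lift ⟨shortestDist c', shortestDist_comm c'⟩ (e : Sym2 V)

/-- The constraints of the path version of the Held-Karp relaxation, on the complete graph. -/
structure LP1Feasible {V : Type*} [Fintype V] [DecidableEq V] (s t : V)
    (x : (⊤ : SimpleGraph V).edgeSet → ℝ) : Prop where
  degree_s : ∑ e ∈ delta ⊤ {s}, x e = 1
  degree_t : ∑ e ∈ delta ⊤ {t}, x e = 1
  degree : ∀ v, v ≠ s → v ≠ t → ∑ e ∈ delta ⊤ {v}, x e = 2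
  st_cut : ∀ S : Finset V, S.Nonempty → S ≠ Finset.univ → (S ∩ {s, t}).card = 1 →
    1 ≤ ∑ e ∈ delta ⊤ S, x e
  even_cut : ∀ S : Finset V, S.Nonempty → S ≠ Finset.univ → Even (S ∩ {s, t}).card →
    2 ≤ ∑ e ∈ delta ⊤ S, x e
  nonneg : ∀ e, 0 ≤ x e
  le_one : ∀ e, x e ≤ 1

/-- The constraints of the weaker relaxation, on the original graph `H`. -/
structure LP4Feasible {V : Type*} [Fintype V] [DecidableEq V] (H : SimpleGraph V) (s t : V)
    (x : H.edgeSet → ℝ) : Prop where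
  partition : ∀ 𝒲 : Finpartition (Finset.univ : Finset V),
    (𝒲.parts.card : ℝ) - 1 ≤ ∑ e ∈ deltaPartition H 𝒲, x e
  even_cut : ∀ S : Finset V, S.Nonempty → S ≠ Finset.univ → Even (S ∩ {s, t}).card →
    2 ≤ ∑ e ∈ delta H S, x e
  nonneg : ∀ e, 0 ≤ x e

/-- The costs of the integral solutions of the first relaxation on the metric completion. -/
def intCosts1 {V : Type*} [Fintype V] [DecidableEq V] {H : SimpleGraph V}
    (c' : H.edgeSet → ℝ) (s t : V) : Set ℝ :=
  {r | ∃ x, LP1Feasible s t x ∧ IsIntegral x ∧ cost (metricCost c') x = r}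

/-- The costs of the integral solutions of the second relaxation on `H`. -/
def intCosts4 {V : Type*} [Fintype V] [DecidableEq V] {H : SimpleGraph V}
    (c' : H.edgeSet → ℝ) (s t : V) : Set ℝ :=
  {r | ∃ x, LP4Feasible H s t x ∧ IsIntegral x ∧ cost c' x = r}

/-- The optimal integral value of the first relaxation. -/
noncomputable def optInt1 {V : Type*} [Fintype V] [DecidableEq V] {H : SimpleGraph V}
    (c' : H.edgeSet → ℝ) (s t : V) : ℝ :=
  sInf (intCosts1 c' s t)

/-- The optimal integral value of the second relaxation. -/
noncomputable def optInt4 {V : Type*} [Fintype V] [DecidableEq V] {H : SimpleGraph V}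
    (c' : H.edgeSet → ℝ) (s t : V) : ℝ :=
  sInf (intCosts4 c' s t)

end PathTSP

/-! Lower bound: in an integral solution on the metric completion, replace every edge by a shortest
path of `H` (`exists_expansion`). The cost is unchanged, no cut gets lighter, and cut bounds alone
imply the partition inequalities (`cut_partition`).

Upper bound: an integral solution `Y` on `H` is a connected multigraph. Let `T` be the set of
vertices whose degree parity is wrong for an `s`-`t` trail. A cut with an odd number of `T`-vertices
on one side has `Y`-weight at least 2: if it does not separate `s` from `t` this is a constraint,
and otherwise its weight is even and positive. Hence a uniformly random `T`-join in the support of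
`Y` costs on average at most half of `Y` (`exists_join_le_half`): an edge on a cycle is used with
probability 1/2, and a bridge that is used has multiplicity at least 2. Adding such a join to `Y`
allows a spanning `s`-`t` trail, which is shortcut to a Hamiltonian path of the completion.

Tightness: on a complete graph both optima are `n - 1`. On a cycle of length `2k` with `s`, `t`
antipodal, the all-ones vector costs `2k`. In an expanded integral solution of the first relaxation,
one of the two `s`-`t` paths has all multiplicities odd and the other all even with at most one
zero, so the cost is at least `k + 2(k - 1)`. -/

namespace PathTSP

/-! ### Linear algebra over the two-element field, and joins of small cost. -/

theorem exists_dual_indicator_of_forall_ker {E V : Type*} [Fintype V] [DecidableEq V]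
    {K : Type*} [Field K] (B : (E → K) →ₗ[K] (V → K)) (e : E) (h : ∀ z, B z = 0 → z e = 0) :
    ∃ f : V → K, ∀ z, z e = ∑ v, f v * B z v := by
  -- A functional vanishing on the kernel factors through `B`. For graphs: an edge on no cycle is
  -- the only edge of some cut.
  have hmem : (LinearMap.proj e : (E → K) →ₗ[K] K) ∈ LinearMap.range B.dualMap := by
    rw [LinearMap.range_dualMap_eq_dualAnnihilator_ker, Submodule.mem_dualAnnihilator]
    intro z hz
    exact h z (LinearMap.mem_ker.1 hz)
  obtain ⟨φ, hφ⟩ := hmem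
  refine ⟨fun v => φ (Pi.single v 1), fun z => ?_⟩
  have h1 : z e = φ (B z) := by
    have := LinearMap.congr_fun hφ z
    simpa using this.symm
  rw [h1, LinearMap.pi_apply_eq_sum_univ φ (B z)]
  refine Finset.sum_congr rfl fun v _ => ?_
  rw [smul_eq_mul, mul_comm]
  congr 2
  ext w
  simp [Pi.single_apply, eq_comm]

/-- A functional separates `τ` from the range. For graphs, `f` is a cut that no edge crosses
although one side has odd `τ`-parity. -/
theorem exists_dual_ne_zero_of_notMem_range {E V : Type*} [Fintype V] [DecidableEq V]
    {K : Type*} [Field K] (B : (E → K) →ₗ[K] (V → K)) (τ : V → K)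
    (h : τ ∉ LinearMap.range B) :
    ∃ f : V → K, ∑ v, f v * τ v ≠ 0 ∧ ∀ z, ∑ v, f v * B z v = 0 := by
  obtain ⟨φ, hφτ, hφ⟩ := Submodule.exists_le_ker_of_notMem h
  have key : ∀ p : V → K, φ p = ∑ v, φ (Pi.single v 1) * p v := by
    intro p
    rw [LinearMap.pi_apply_eq_sum_univ φ p]
    refine Finset.sum_congr rfl fun v _ => ?_
    rw [smul_eq_mul, mul_comm]
    congr 2
    ext w
    simp [Pi.single_apply, eq_comm]
  refine ⟨fun v => φ (Pi.single v 1), ?_, fun z => ?_⟩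
  · rwa [← key]
  · rw [← key]
    exact LinearMap.mem_ker.1 (hφ ⟨z, rfl⟩)

theorem zmod_two_eq_one {a : ZMod 2} (h : a ≠ 0) : a = 1 := by
  revert h
  revert a
  decide

/-- Averaging over a coset of a binary vector space: a coordinate that is not constant is nonzero
on half of the coset. -/
theorem two_mul_sum_coset_coordinate {E : Type*} [Fintype E] [DecidableEq E]
    (Z : Submodule (ZMod 2) (E → ZMod 2)) [Fintype Z] (J : E → ZMod 2) (e : E)
    (h : ∃ z ∈ Z, z e ≠ 0) :
    2 * ∑ z : Z, (if (J + (z : E → ZMod 2)) e ≠ 0 then (1 : ℝ) else 0) = Fintype.card Z := by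
  obtain ⟨z₀, hz₀, hne⟩ := h
  have h1 : ∑ z : Z, (if (J + (z : E → ZMod 2)) e ≠ 0 then (1 : ℝ) else 0) =
      ∑ z : Z, (if (J + ((z + ⟨z₀, hz₀⟩ : Z) : E → ZMod 2)) e ≠ 0 then (1 : ℝ) else 0) :=
    (Equiv.sum_comp (Equiv.addRight (⟨z₀, hz₀⟩ : Z))
      (fun z : Z => if (J + (z : E → ZMod 2)) e ≠ 0 then (1 : ℝ) else 0)).symm
  rw [two_mul]
  nth_rewrite 2 [h1]
  rw [← Finset.sum_add_distrib]
  have h2 : ∀ z : Z, (if (J + (z : E → ZMod 2)) e ≠ 0 then (1 : ℝ) else 0) +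
      (if (J + ((z + ⟨z₀, hz₀⟩ : Z) : E → ZMod 2)) e ≠ 0 then (1 : ℝ) else 0) = 1 := by
    intro z
    have h3 : (J + ((z + ⟨z₀, hz₀⟩ : Z) : E → ZMod 2)) e = (J + (z : E → ZMod 2)) e + 1 := by
      simp [zmod_two_eq_one hne, add_assoc]
    simp only [h3]
    generalize (J + (z : E → ZMod 2)) e = a
    have : a = 0 ∨ a = 1 := by revert a; decide
    rcases this with rfl | rfl
    · simp
    · have : (1 + 1 : ZMod 2) = 0 := by decide
      simp [this]
  rw [Finset.sum_congr rfl fun z _ => h2 z]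
  simp

/-- A parity vector `τ` all of whose odd cuts have weight at least two in the integral vector `y`
is the boundary of a set of elements of cost at most half of the cost of `y`. -/
theorem exists_join_le_half {E V : Type*} [Fintype E] [DecidableEq E] [Fintype V] [DecidableEq V]
    (inc : E → V → ZMod 2) (y : E → ℕ) (τ : V → ZMod 2) (w : E → ℝ) (hw : ∀ e, 0 ≤ w e)
    (hcut : ∀ f : V → ZMod 2, ∑ v, f v * τ v ≠ 0 →
      2 ≤ ∑ e with ∑ v, f v * inc e v ≠ 0, y e) :
    ∃ J : E → ℕ, (∀ v, ∑ e, (J e : ZMod 2) * inc e v = τ v) ∧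
      ∑ e, w e * (J e : ℝ) ≤ 1 / 2 * ∑ e, w e * (y e : ℝ) := by
  classical
  -- The mask `m` restricts the boundary map to the support of `y`. Coordinates off the support stay
  -- free and are discarded at the end.
  let m : E → ZMod 2 := fun e => if y e = 0 then 0 else 1
  let B : (E → ZMod 2) →ₗ[ZMod 2] (V → ZMod 2) :=
    { toFun := fun z v => ∑ e, z e * m e * inc e v
      map_add' := fun z z' => by
        ext v; simp [add_mul, Finset.sum_add_distrib]
      map_smul' := fun a z => by
        ext v; simp [Finset.mul_sum, mul_assoc] }
  have hB : ∀ z v, B z v = ∑ e, z e * m e * inc e v := fun _ _ => rfl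
  have hfB : ∀ (f : V → ZMod 2) z, ∑ v, f v * B z v = ∑ e, z e * (m e * ∑ v, f v * inc e v) := by
    intro f z
    simp only [hB, Finset.mul_sum]
    rw [Finset.sum_comm]
    refine Finset.sum_congr rfl fun e _ => Finset.sum_congr rfl fun v _ => by ring
  have hfB1 : ∀ (f : V → ZMod 2) e, ∑ v, f v * B (Pi.single e 1) v = m e * ∑ v, f v * inc e v := by
    intro f e
    rw [hfB]
    simp [Pi.single_apply]
  obtain ⟨J₀, hJ₀⟩ : τ ∈ LinearMap.range B := by
    by_contra hτ
    obtain ⟨f, hf1, hf2⟩ := exists_dual_ne_zero_of_notMem_range B τ hτ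
    have h2 := hcut f hf1
    have h0 : ∑ e with ∑ v, f v * inc e v ≠ 0, y e = 0 := by
      refine Finset.sum_eq_zero fun e he => ?_
      have h3 := hf2 (Pi.single e 1)
      rw [hfB1] at h3
      rcases mul_eq_zero.1 h3 with h4 | h4
      · by_contra hy
        simp [m, hy] at h4
      · exact absurd h4 (Finset.mem_filter.1 he).2
    omega
  let Z := LinearMap.ker B
  have hcard : (0 : ℝ) < Fintype.card Z := by exact_mod_cast Fintype.card_pos
  have hcoord : ∀ e, ∑ z : Z, (if y e ≠ 0 ∧ (J₀ + (z : E → ZMod 2)) e ≠ 0 then (1 : ℝ) else 0) ≤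
      Fintype.card Z * (1 / 2 * y e) := by
    intro e
    by_cases hy : y e = 0
    · simp [hy]
    have hy1 : (1 : ℝ) ≤ y e := by exact_mod_cast Nat.one_le_iff_ne_zero.2 hy
    simp only [ne_eq, hy, not_false_eq_true, true_and]
    by_cases hz : ∃ z ∈ Z, z e ≠ 0
    · have := two_mul_sum_coset_coordinate Z J₀ e hz
      simp only [ne_eq] at this
      nlinarith
    push Not at hz
    -- The coordinate `e` is constant on the coset (a bridge of the support). If the constant is 1,
    -- then `f` is an odd cut met by the support in `e` alone, so `y e ≥ 2` pays for using `e`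
    -- always.
    obtain ⟨f, hf⟩ := exists_dual_indicator_of_forall_ker B e
      (fun z hz' => hz z (LinearMap.mem_ker.2 hz'))
    by_cases hJe : J₀ e = 0
    · have : ∀ z : Z, (J₀ + (z : E → ZMod 2)) e = 0 := by
        intro z
        rw [Pi.add_apply, hJe, hz z z.2, add_zero]
      simp only [this]
      simp only [not_true_eq_false, if_false, Finset.sum_const_zero]
      positivity
    · have h2 := hcut f (by
        have := hf J₀
        rw [hJ₀] at this
        rwa [← this])
      have h3 : ∑ e' with ∑ v, f v * inc e' v ≠ 0, y e' ≤ y e := by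
        rw [← Finset.sum_singleton y e]
        refine Finset.sum_le_sum_of_ne_zero fun e' he' hy' => ?_
        rw [Finset.mem_singleton]
        by_contra hne
        have h4 := hf (Pi.single e' 1)
        rw [hfB1, Pi.single_eq_of_ne (Ne.symm hne)] at h4
        simp only [m, hy', if_false, one_mul] at h4
        exact (Finset.mem_filter.1 he').2 h4.symm
      have hy2 : (2 : ℝ) ≤ y e := by exact_mod_cast h2.trans h3
      calc _ ≤ ∑ z : Z, (1 : ℝ) := Finset.sum_le_sum fun z _ => by split_ifs <;> norm_num
        _ = Fintype.card Z := by simp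
        _ ≤ _ := by nlinarith
  -- Some member of the coset costs at most the average.
  obtain ⟨z, -, hz⟩ : ∃ z ∈ (Finset.univ : Finset Z),
      ∑ e, w e * (if y e ≠ 0 ∧ (J₀ + (z : E → ZMod 2)) e ≠ 0 then (1 : ℝ) else 0) ≤
        1 / 2 * ∑ e, w e * (y e : ℝ) := by
    refine Finset.exists_le_of_sum_le Finset.univ_nonempty ?_
    rw [Finset.sum_comm]
    calc _ = ∑ e, w e * ∑ z : Z,
          (if y e ≠ 0 ∧ (J₀ + (z : E → ZMod 2)) e ≠ 0 then (1 : ℝ) else 0) := by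
          simp only [Finset.mul_sum]
      _ ≤ ∑ e, w e * (Fintype.card Z * (1 / 2 * y e)) :=
          Finset.sum_le_sum fun e _ => mul_le_mul_of_nonneg_left (hcoord e) (hw e)
      _ = _ := by
          rw [Finset.sum_const, Finset.card_univ, nsmul_eq_mul, Finset.mul_sum, Finset.mul_sum]
          exact Finset.sum_congr rfl fun e _ => by ring
  refine ⟨fun e => if y e ≠ 0 ∧ (J₀ + (z : E → ZMod 2)) e ≠ 0 then 1 else 0, fun v => ?_, ?_⟩
  · have h1 : B (J₀ + z) = τ := by
      rw [map_add, hJ₀, LinearMap.mem_ker.1 z.2, add_zero]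
    rw [← h1, hB]
    refine Finset.sum_congr rfl fun e _ => ?_
    congr 1
    by_cases hy : y e = 0
    · simp [m, hy]
    · by_cases hj : (J₀ + (z : E → ZMod 2)) e = 0
      · simp [hj]
      · beta_reduce
        rw [if_pos ⟨hy, hj⟩, zmod_two_eq_one hj]
        simp [m, hy]
  · push_cast
    exact hz

/-- A nonnegative linear cost attains its minimum on every nonempty family of vectors of natural
numbers. -/
theorem exists_min_cost {ι E : Type*} [Fintype E] [Nonempty ι] (c : E → ℝ) (hc : ∀ e, 0 ≤ c e)
    (k : ι → E → ℕ) :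
    ∃ i, ∀ j, ∑ e, c e * (k i e : ℝ) ≤ ∑ e, c e * (k j e : ℝ) := by
  let F : ι → ℝ := fun i => ∑ e, c e * (k i e : ℝ)
  have hwf : WellFounded (fun i j => F i < F j) := by
    have : IsStrictOrder ι (fun i j => F i < F j) :=
      { irrefl := fun _ => lt_irrefl _, trans := fun _ _ _ => lt_trans }
    rw [RelEmbedding.wellFounded_iff_isEmpty]
    refine ⟨fun g => ?_⟩
    -- Dickson's lemma: a sequence of vectors of naturals has an earlier term below a later one, so
    -- costs cannot decrease strictly forever.
    obtain ⟨a, b, hab, hle⟩ := wellQuasiOrdered_le (α := E → ℕ) (fun n => k (g n))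
    have h1 : F (g b) < F (g a) := g.map_rel_iff.2 hab
    have h2 : F (g a) ≤ F (g b) := Finset.sum_le_sum fun e _ =>
      mul_le_mul_of_nonneg_left (by exact_mod_cast hle e) (hc e)
    exact absurd h1 (not_lt.2 h2)
  obtain ⟨i, -, hi⟩ := hwf.has_min Set.univ Set.univ_nonempty
  exact ⟨i, fun j => not_lt.1 (hi j trivial)⟩

theorem natCast_zmod_two_eq_zero_iff {n : ℕ} : (n : ZMod 2) = 0 ↔ Even n := by
  rw [ZMod.natCast_eq_zero_iff, even_iff_two_dvd]

/-! ### Walks as edge multisets. -/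

section Walks

variable {V : Type*} {G : SimpleGraph V}

/-- The edge joining two adjacent vertices. -/
def mkEdge {a b : V} (h : G.Adj a b) : G.edgeSet :=
  ⟨s(a, b), h⟩

theorem coe_mkEdge {a b : V} (h : G.Adj a b) : (mkEdge h : Sym2 V) = s(a, b) :=
  rfl

theorem exists_edge_eq_mkEdge (e : G.edgeSet) : ∃ a b, ∃ h : G.Adj a b, e = mkEdge h := by
  obtain ⟨e, he⟩ := e
  induction e using Sym2.ind with
  | _ a b => exact ⟨a, b, he, rfl⟩

theorem cost_eq_sum [Fintype G.edgeSet] (c x : G.edgeSet → ℝ) :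
    cost c x = ∑ e, c e * x e :=
  finsum_eq_sum_of_fintype _

theorem walkCost_cons (c : G.edgeSet → ℝ) {u v w : V} (h : G.Adj u v) (p : G.Walk v w) :
    walkCost c (SimpleGraph.Walk.cons h p) = c (mkEdge h) + walkCost c p := by
  simp [walkCost, SimpleGraph.Dart.edge, mkEdge]

theorem walkCost_append (c : G.edgeSet → ℝ) {u v w : V} (p : G.Walk u v) (q : G.Walk v w) :
    walkCost c (p.append q) = walkCost c p + walkCost c q := by
  simp [walkCost]

theorem walkCost_nil (c : G.edgeSet → ℝ) (u : V) :
    walkCost c (SimpleGraph.Walk.nil : G.Walk u u) = 0 := by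
  simp [walkCost]

theorem walkCost_nonneg {c : G.edgeSet → ℝ} (hc : ∀ e, 0 ≤ c e) {u v : V} (p : G.Walk u v) :
    0 ≤ walkCost c p := by
  induction p with
  | nil => simp [walkCost_nil]
  | cons h p ih => rw [walkCost_cons]; exact add_nonneg (hc _) ih

variable [DecidableEq V]

/-- How often a walk traverses each edge. -/
def edgeCount {u v : V} (p : G.Walk u v) : G.edgeSet → ℕ :=
  fun e => p.edges.count (e : Sym2 V)

theorem edgeCount_nil (u : V) : edgeCount (SimpleGraph.Walk.nil : G.Walk u u) = 0 := by
  ext e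
  simp [edgeCount]

theorem edgeCount_cons {u v w : V} (h : G.Adj u v) (p : G.Walk v w) :
    edgeCount (SimpleGraph.Walk.cons h p) = edgeCount p + Pi.single (mkEdge h) 1 := by
  ext e
  simp only [edgeCount, SimpleGraph.Walk.edges_cons, List.count_cons, Pi.add_apply,
    Pi.single_apply, beq_iff_eq]
  congr 1
  refine if_congr ?_ rfl rfl
  rw [Subtype.ext_iff, coe_mkEdge]
  exact eq_comm

theorem edgeCount_append {u v w : V} (p : G.Walk u v) (q : G.Walk v w) :
    edgeCount (p.append q) = edgeCount p + edgeCount q := by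
  ext e
  simp [edgeCount]

theorem edgeCount_reverse {u v : V} (p : G.Walk u v) : edgeCount p.reverse = edgeCount p := by
  ext e
  simp [edgeCount]

theorem card_inter_pair_zmod (S : Finset V) {s t : V} (hst : s ≠ t) :
    ((S ∩ {s, t}).card : ZMod 2) = (if s ∈ S then 1 else 0) + (if t ∈ S then 1 else 0) := by
  have h2 : (2 : ZMod 2) = 1 + 1 := by decide
  by_cases hs : s ∈ S <;> by_cases ht : t ∈ S <;>
    simp [hs, ht, hst, h2, Finset.inter_insert_of_mem, Finset.inter_insert_of_notMem]

theorem card_inter_pair_le (S : Finset V) (s t : V) : (S ∩ {s, t}).card ≤ 2 :=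
  (Finset.card_le_card Finset.inter_subset_right).trans Finset.card_le_two

theorem walkCost_eq_cost [Finite G.edgeSet] (c : G.edgeSet → ℝ) {u v : V} (p : G.Walk u v) :
    walkCost c p = cost c fun e => (edgeCount p e : ℝ) := by
  have := Fintype.ofFinite G.edgeSet
  rw [cost_eq_sum]
  induction p with
  | nil => simp [walkCost_nil, edgeCount_nil]
  | cons h p ih =>
    rw [walkCost_cons, ih, edgeCount_cons]
    simp [mul_add, Finset.sum_add_distrib, Pi.single_apply, add_comm]

end Walks

/-! ### Cuts, their parities, and partition inequalities. -/

section Cuts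

variable {V : Type*} [Fintype V] {G : SimpleGraph V}

theorem mem_delta {S : Finset V} {e : G.edgeSet} :
    e ∈ delta G S ↔ ∃ u ∈ S, ∃ v ∉ S, (e : Sym2 V) = s(u, v) := by
  simp [delta]

theorem mkEdge_mem_delta {S : Finset V} {a b : V} (h : G.Adj a b) :
    mkEdge h ∈ delta G S ↔ a ∈ S ∧ b ∉ S ∨ b ∈ S ∧ a ∉ S := by
  rw [mem_delta]
  constructor
  · rintro ⟨u, hu, v, hv, he⟩
    rcases Sym2.eq_iff.1 he with ⟨rfl, rfl⟩ | ⟨rfl, rfl⟩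
    · exact Or.inl ⟨hu, hv⟩
    · exact Or.inr ⟨hu, hv⟩
  · rintro (⟨ha, hb⟩ | ⟨hb, ha⟩)
    · exact ⟨a, ha, b, hb, rfl⟩
    · exact ⟨b, hb, a, ha, Sym2.eq_swap⟩

theorem delta_univ : delta G Finset.univ = ∅ := by
  ext e
  simp [mem_delta]

variable [DecidableEq V]

theorem mem_deltaPartition {𝒲 : Finpartition (Finset.univ : Finset V)} {e : G.edgeSet} :
    e ∈ deltaPartition G 𝒲 ↔ ∃ W ∈ 𝒲.parts, e ∈ delta G W := by
  simp [deltaPartition]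

theorem delta_compl (S : Finset V) : delta G Sᶜ = delta G S := by
  ext e
  obtain ⟨a, b, h, rfl⟩ := exists_edge_eq_mkEdge e
  rw [mkEdge_mem_delta, mkEdge_mem_delta, Finset.mem_compl, Finset.mem_compl]
  tauto

/-- Modulo 2 an edge with both ends inside contributes `1 + 1 = 0`, so crossing a cut is linear in
the ends. The parity arguments rest on this. -/
theorem ite_mem_delta_zmod (S : Finset V) {a b : V} (h : G.Adj a b) :
    (if mkEdge h ∈ delta G S then 1 else 0 : ZMod 2) =
      (if a ∈ S then 1 else 0) + (if b ∈ S then 1 else 0) := by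
  simp only [mkEdge_mem_delta]
  have : (1 + 1 : ZMod 2) = 0 := by decide
  by_cases ha : a ∈ S <;> by_cases hb : b ∈ S <;> simp [ha, hb, this]

theorem ite_mem_delta_eq_sum (S : Finset V) (e : G.edgeSet) :
    (if e ∈ delta G S then 1 else 0 : ZMod 2) =
      ∑ v ∈ S, (if e ∈ delta G {v} then 1 else 0) := by
  obtain ⟨a, b, h, rfl⟩ := exists_edge_eq_mkEdge e
  simp only [ite_mem_delta_zmod, Finset.mem_singleton, Finset.sum_add_distrib,
    Finset.sum_ite_eq]

/-- The weight of a cut has the same parity as the sum of the degrees on one side. -/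
theorem sum_delta_zmod_eq (X : G.edgeSet → ℕ) (S : Finset V) :
    ((∑ e ∈ delta G S, X e : ℕ) : ZMod 2) = ∑ v ∈ S, ((∑ e ∈ delta G {v}, X e : ℕ) : ZMod 2) := by
  classical
  have := Fintype.ofFinite G.edgeSet
  have h : ∀ T : Finset V, ((∑ e ∈ delta G T, X e : ℕ) : ZMod 2) =
      ∑ e, (X e : ZMod 2) * (if e ∈ delta G T then 1 else 0) := by
    intro T
    simp [Finset.sum_ite_mem]
  simp only [h]
  rw [Finset.sum_comm]
  refine Finset.sum_congr rfl fun e _ => ?_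
  rw [ite_mem_delta_eq_sum, Finset.mul_sum]

theorem sum_delta_single (S : Finset V) (e : G.edgeSet) :
    ∑ e' ∈ delta G S, (Pi.single e 1 : G.edgeSet → ℕ) e' = if e ∈ delta G S then 1 else 0 := by
  simp [Pi.single_apply]

theorem sum_delta_edgeCount_cons (S : Finset V) {u v w : V} (h : G.Adj u v) (p : G.Walk v w) :
    ∑ e ∈ delta G S, edgeCount (SimpleGraph.Walk.cons h p) e =
      ∑ e ∈ delta G S, edgeCount p e +
        if mkEdge h ∈ delta G S then 1 else 0 := by
  rw [edgeCount_cons]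
  simp only [Pi.add_apply, Finset.sum_add_distrib, sum_delta_single]

/-- A walk crosses a cut an odd number of times if and only if the cut separates its ends. -/
theorem sum_delta_edgeCount_zmod (S : Finset V) {u v : V} (p : G.Walk u v) :
    ((∑ e ∈ delta G S, edgeCount p e : ℕ) : ZMod 2) =
      (if u ∈ S then 1 else 0) + (if v ∈ S then 1 else 0) := by
  have h2 : (1 + 1 : ZMod 2) = 0 := by decide
  induction p with
  | nil => simp [edgeCount_nil]; split_ifs <;> simp [h2]
  | @cons a b c h p ih =>
    rw [sum_delta_edgeCount_cons, Nat.cast_add, ih, Nat.cast_ite, Nat.cast_one, Nat.cast_zero,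
      ite_mem_delta_zmod]
    generalize (if a ∈ S then 1 else 0 : ZMod 2) = x
    generalize (if b ∈ S then 1 else 0 : ZMod 2) = y
    generalize (if c ∈ S then 1 else 0 : ZMod 2) = z
    revert x y z
    decide

theorem one_le_sum_delta_edgeCount_of_ends {S : Finset V} {u v : V} (p : G.Walk u v)
    (hu : u ∈ S) (hv : v ∉ S) : 1 ≤ ∑ e ∈ delta G S, edgeCount p e := by
  obtain ⟨d, hd, h1, h2⟩ := p.exists_boundary_dart (S : Set V) hu hv
  have hmem : (⟨d.edge, d.edge_mem⟩ : G.edgeSet) ∈ delta G S :=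
    mem_delta.2 ⟨d.fst, h1, d.snd, h2, rfl⟩
  refine le_trans ?_ (Finset.single_le_sum (fun _ _ => Nat.zero_le _) hmem)
  exact List.one_le_count_iff.2 (List.mem_map_of_mem hd)

theorem one_le_sum_delta_edgeCount {S : Finset V} {u v a b : V} (p : G.Walk u v)
    (ha : a ∈ p.support) (hb : b ∈ p.support) (haS : a ∈ S) (hbS : b ∉ S) :
    1 ≤ ∑ e ∈ delta G S, edgeCount p e := by
  by_cases hu : u ∈ S
  · have h := one_le_sum_delta_edgeCount_of_ends (p.takeUntil b hb) hu hbS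
    refine h.trans ?_
    conv_rhs => rw [← p.take_spec hb, edgeCount_append]
    exact Finset.sum_le_sum fun e _ => by simp
  · have h := one_le_sum_delta_edgeCount_of_ends (S := Sᶜ) (p.takeUntil a ha)
      (Finset.mem_compl.2 hu) (by simpa using haS)
    rw [delta_compl] at h
    refine h.trans ?_
    conv_rhs => rw [← p.take_spec ha, edgeCount_append]
    exact Finset.sum_le_sum fun e _ => by simp

/-- Each part `W` has cut weight at least `2 - |W ∩ {s, t}|`. Summing over the parts gives at least
`2|𝒲| - 2`, while every edge is counted at most twice. -/
theorem cut_partition {x : G.edgeSet → ℝ} (hx : ∀ e, 0 ≤ x e) {s t : V}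
    (hodd : ∀ S : Finset V, S.Nonempty → S ≠ Finset.univ → (S ∩ {s, t}).card = 1 →
      1 ≤ ∑ e ∈ delta G S, x e)
    (heven : ∀ S : Finset V, S.Nonempty → S ≠ Finset.univ → Even (S ∩ {s, t}).card →
      2 ≤ ∑ e ∈ delta G S, x e)
    (𝒲 : Finpartition (Finset.univ : Finset V)) :
    (𝒲.parts.card : ℝ) - 1 ≤ ∑ e ∈ deltaPartition G 𝒲, x e := by
  classical
  -- With at most one part the bound is trivial. Otherwise no part is the whole vertex set, so the
  -- cut hypotheses apply to every part.
  by_cases hle : 𝒲.parts.card ≤ 1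
  · have : (𝒲.parts.card : ℝ) ≤ 1 := by exact_mod_cast hle
    have h0 : 0 ≤ ∑ e ∈ deltaPartition G 𝒲, x e := Finset.sum_nonneg fun e _ => hx e
    linarith
  have hne : ∀ W ∈ 𝒲.parts, W ≠ Finset.univ := by
    rintro W hW rfl
    refine hle (Finset.card_le_one.2 ?_)
    have : ∀ A ∈ 𝒲.parts, A = Finset.univ := by
      intro A hA
      by_contra hA'
      have hd : Disjoint A Finset.univ := 𝒲.disjoint hA hW hA'
      rw [Finset.disjoint_iff_ne] at hd
      obtain ⟨a, ha⟩ := 𝒲.nonempty_of_mem_parts hA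
      exact hd a ha a (Finset.mem_univ a) rfl
    intro A hA B hB
    rw [this A hA, this B hB]
  have hlow : ∀ W ∈ 𝒲.parts, (2 : ℝ) - (W ∩ {s, t}).card ≤ ∑ e ∈ delta G W, x e := by
    intro W hW
    have h1 := 𝒲.nonempty_of_mem_parts hW
    have h2 := hne W hW
    have h3 := card_inter_pair_le W s t
    interval_cases hc : (W ∩ {s, t}).card
    · have := heven W h1 h2 (by rw [hc]; decide)
      push_cast; linarith
    · have := hodd W h1 h2 hc
      push_cast; linarith
    · have := heven W h1 h2 (by rw [hc]; decide)
      push_cast; linarith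
  have hcard : ∑ W ∈ 𝒲.parts, (W ∩ {s, t}).card ≤ 2 := by
    rw [← Finset.card_biUnion]
    · refine le_trans (Finset.card_le_card ?_) (Finset.card_le_two (a := s) (b := t))
      exact Finset.biUnion_subset.2 fun W _ => Finset.inter_subset_right
    · intro A hA B hB hAB
      exact (𝒲.disjoint hA hB hAB).mono Finset.inter_subset_left Finset.inter_subset_left
  have hcardR : (∑ W ∈ 𝒲.parts, ((W ∩ {s, t}).card : ℝ)) ≤ 2 := by exact_mod_cast hcard
  have hup : ∑ W ∈ 𝒲.parts, ∑ e ∈ delta G W, x e ≤ 2 * ∑ e ∈ deltaPartition G 𝒲, x e := by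
    have h1 : ∀ W ∈ 𝒲.parts, ∑ e ∈ delta G W, x e =
        ∑ e ∈ deltaPartition G 𝒲, if e ∈ delta G W then x e else 0 := by
      intro W hW
      rw [Finset.sum_ite_mem]
      congr 1
      ext e
      simp only [Finset.mem_inter, mem_deltaPartition]
      exact ⟨fun h => ⟨⟨W, hW, h⟩, h⟩, fun h => h.2⟩
    rw [Finset.sum_congr rfl h1, Finset.sum_comm, Finset.mul_sum]
    refine Finset.sum_le_sum fun e _ => ?_
    rw [← Finset.sum_filter, Finset.sum_const, nsmul_eq_mul]
    refine mul_le_mul_of_nonneg_right ?_ (hx e)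
    have h2 : (𝒲.parts.filter fun W => e ∈ delta G W).card ≤ 2 := by
      obtain ⟨a, b, h, rfl⟩ := exists_edge_eq_mkEdge e
      refine le_trans (Finset.card_le_card (t := {𝒲.part a, 𝒲.part b}) ?_) Finset.card_le_two
      intro W hW
      rw [Finset.mem_filter, mkEdge_mem_delta] at hW
      rw [Finset.mem_insert, Finset.mem_singleton]
      rcases hW.2 with h | h
      · exact Or.inl (𝒲.part_eq_of_mem hW.1 h.1).symm
      · exact Or.inr (𝒲.part_eq_of_mem hW.1 h.1).symm
    exact_mod_cast h2
  have hsum := Finset.sum_le_sum hlow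
  rw [Finset.sum_sub_distrib, Finset.sum_const, nsmul_eq_mul] at hsum
  linarith

/-- The inequality of the partition `{S, Sᶜ}`, whose parts have the same cut. -/
theorem LP4Feasible.one_le_cut {H : SimpleGraph V} {s t : V} {x : H.edgeSet → ℝ}
    (hx : LP4Feasible H s t x) {S : Finset V} (hS : S.Nonempty) (hS' : S ≠ Finset.univ) :
    1 ≤ ∑ e ∈ delta H S, x e := by
  have hSc : Sᶜ ≠ ⊥ := by
    rw [Finset.bot_eq_empty, ne_eq, Finset.compl_eq_empty_iff]
    exact hS'
  let 𝒲 : Finpartition (Finset.univ : Finset V) :=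
    (Finpartition.indiscrete (Finset.nonempty_iff_ne_empty.1 hS)).extend hSc disjoint_compl_right
      sup_compl_eq_top
  have hparts : 𝒲.parts = {Sᶜ, S} := rfl
  have h := hx.partition 𝒲
  have hne : Sᶜ ≠ S := by
    intro heq
    obtain ⟨a, ha⟩ := hS
    have ha' := ha
    rw [← heq] at ha'
    exact Finset.mem_compl.1 ha' ha
  rw [hparts, Finset.card_pair hne] at h
  have hδ : deltaPartition H 𝒲 = delta H S := by
    ext e
    rw [mem_deltaPartition, hparts]
    simp [delta_compl]
  rw [hδ] at h
  push_cast at h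
  linarith

end Cuts

/-! ### Eulerian trails. -/

section Trails

variable {V : Type*} [Fintype V] {G : SimpleGraph V}

theorem exists_eq_add_single {E : Type*} [DecidableEq E] {W : E → ℕ} {e : E} (h : W e ≠ 0) :
    ∃ W' : E → ℕ, W = W' + Pi.single e 1 := by
  refine ⟨W - Pi.single e 1, ?_⟩
  ext e'
  by_cases he : e' = e
  · subst he
    simp only [Pi.add_apply, Pi.sub_apply, Pi.single_eq_same]
    omega
  · simp [he]

theorem exists_adj_of_mem_delta_singleton {a : V} {e : G.edgeSet} (he : e ∈ delta G {a}) :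
    ∃ b, ∃ h : G.Adj a b, e = mkEdge h := by
  obtain ⟨u, hu, b, -, heq⟩ := mem_delta.1 he
  rw [Finset.mem_singleton] at hu
  subst hu
  have h : G.Adj u b := by
    have := e.2
    rwa [heq] at this
  exact ⟨b, h, Subtype.ext heq⟩

variable [DecidableEq V]

theorem sum_delta_add_single_zmod {W : G.edgeSet → ℕ} (S : Finset V) {a b : V} (h : G.Adj a b) :
    ((∑ e ∈ delta G S, (W + Pi.single (mkEdge h) 1 : G.edgeSet → ℕ) e : ℕ) : ZMod 2) =
      ((∑ e ∈ delta G S, W e : ℕ) : ZMod 2) +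
        ((if a ∈ S then 1 else 0) + (if b ∈ S then 1 else 0)) := by
  simp only [Pi.add_apply, Finset.sum_add_distrib, sum_delta_single, Nat.cast_add, Nat.cast_ite,
    Nat.cast_one, Nat.cast_zero, ite_mem_delta_zmod]

/-- An edge multiset whose vertices of odd degree are exactly the two given ones contains a trail
between them. -/
theorem exists_walk_edgeCount_le [Fintype G.edgeSet] (W : G.edgeSet → ℕ) (u v : V)
    (hW : ∀ x : V, ((∑ e ∈ delta G {x}, W e : ℕ) : ZMod 2) =
      (if u ∈ ({x} : Finset V) then 1 else 0) + (if v ∈ ({x} : Finset V) then 1 else 0)) :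
    ∃ p : G.Walk u v, ∀ e, edgeCount p e ≤ W e := by
  induction hN : ∑ e, W e using Nat.strong_induction_on generalizing W u with
  | _ N ih =>
    by_cases huv : u = v
    · subst huv
      exact ⟨SimpleGraph.Walk.nil, fun e => by simp [edgeCount_nil]⟩
    -- The degree of `u` is odd, so some edge leaves `u`. Removing it moves the odd vertex from `u`
    -- to its other end.
    have h1 : ∑ e ∈ delta G {u}, W e ≠ 0 := by
      intro h0
      have h := hW u
      simp [h0, Ne.symm huv] at h
    obtain ⟨e, he, hne⟩ := Finset.exists_ne_zero_of_sum_ne_zero h1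
    obtain ⟨b, h, rfl⟩ := exists_adj_of_mem_delta_singleton he
    obtain ⟨W', rfl⟩ := exists_eq_add_single hne
    have hlt : ∑ e, W' e < N := by
      rw [← hN]
      simp [Finset.sum_add_distrib]
    obtain ⟨p, hp⟩ := ih _ hlt W' b (fun x => by
      have hx := hW x
      rw [sum_delta_add_single_zmod] at hx
      revert hx
      generalize ((∑ e ∈ delta G {x}, W' e : ℕ) : ZMod 2) = q
      generalize (if u ∈ ({x} : Finset V) then 1 else 0 : ZMod 2) = x₁
      generalize (if v ∈ ({x} : Finset V) then 1 else 0 : ZMod 2) = x₂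
      generalize (if b ∈ ({x} : Finset V) then 1 else 0 : ZMod 2) = x₃
      revert q x₁ x₂ x₃
      decide) rfl
    refine ⟨SimpleGraph.Walk.cons h p, fun e => ?_⟩
    rw [edgeCount_cons, Pi.add_apply, Pi.add_apply]
    exact Nat.add_le_add_right (hp e) _

/-- A connected edge multiset whose vertices of odd degree are exactly `s` and `t` contains a
spanning trail from `s` to `t`. -/
theorem exists_spanning_walk_edgeCount_le [Fintype G.edgeSet] (W : G.edgeSet → ℕ) (s t : V)
    (hW : ∀ x : V, ((∑ e ∈ delta G {x}, W e : ℕ) : ZMod 2) =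
      (if s ∈ ({x} : Finset V) then 1 else 0) + (if t ∈ ({x} : Finset V) then 1 else 0))
    (hconn : ∀ S : Finset V, S.Nonempty → S ≠ Finset.univ → 1 ≤ ∑ e ∈ delta G S, W e) :
    ∃ p : G.Walk s t, (∀ x, x ∈ p.support) ∧ ∀ e, edgeCount p e ≤ W e := by
  obtain ⟨p₀, hp₀⟩ := exists_walk_edgeCount_le W s t hW
  let P := {p : G.Walk s t // ∀ e, edgeCount p e ≤ W e}
  have : Nonempty P := ⟨⟨p₀, hp₀⟩⟩
  -- Minimizing the unused weight selects a longest trail.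
  let F : P → ℕ := fun p => ∑ e, W e - ∑ e, edgeCount p.1 e
  obtain ⟨⟨p, hp⟩, hmin⟩ : ∃ p : P, ∀ q : P, F p ≤ F q :=
    ⟨Function.argmin F, fun q => Function.argmin_le F q⟩
  refine ⟨p, ?_, hp⟩
  by_contra hspan
  push Not at hspan
  obtain ⟨y, hy⟩ := hspan
  have hcut := hconn p.support.toFinset ⟨s, by simp⟩ (fun h => hy (by
    rw [← List.mem_toFinset, h]; exact Finset.mem_univ y))
  obtain ⟨e, he, hne⟩ := Finset.exists_ne_zero_of_sum_ne_zero (Nat.one_le_iff_ne_zero.1 hcut)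
  obtain ⟨a, ha, b, hb, heq⟩ := mem_delta.1 he
  rw [List.mem_toFinset] at ha hb
  have hab : G.Adj a b := by
    have := e.2
    rwa [heq] at this
  obtain rfl : e = mkEdge hab := Subtype.ext heq
  have hzero : edgeCount p (mkEdge hab) = 0 := by
    rw [edgeCount, coe_mkEdge, List.count_eq_zero]
    exact fun h => hb (p.snd_mem_support_of_mem_edges h)
  obtain ⟨R, rfl⟩ : ∃ R : G.edgeSet → ℕ, W = edgeCount p + R :=
    ⟨W - edgeCount p, by ext e'; have := hp e'; simp only [Pi.add_apply, Pi.sub_apply]; omega⟩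
  obtain ⟨R', rfl⟩ := exists_eq_add_single (W := R) (e := mkEdge hab) (by
    simpa [hzero] using hne)
  -- The remainder `R` has only even degrees, since `W` and `p` have the same odd vertices. Without
  -- the edge `ab` it therefore contains a trail from `b` back to `a`; splicing this closed detour
  -- into `p` at `a` makes a longer trail.
  obtain ⟨q, hq⟩ := exists_walk_edgeCount_le R' b a (fun x => by
    have hx := hW x
    simp only [← add_assoc] at hx
    rw [sum_delta_add_single_zmod] at hx
    simp only [Pi.add_apply, Finset.sum_add_distrib, Nat.cast_add] at hx
    have h2 := sum_delta_edgeCount_zmod {x} p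
    rw [h2] at hx
    revert hx
    generalize ((∑ e ∈ delta G {x}, R' e : ℕ) : ZMod 2) = q
    generalize (if s ∈ ({x} : Finset V) then 1 else 0 : ZMod 2) = x₁
    generalize (if t ∈ ({x} : Finset V) then 1 else 0 : ZMod 2) = x₂
    generalize (if a ∈ ({x} : Finset V) then 1 else 0 : ZMod 2) = x₃
    generalize (if b ∈ ({x} : Finset V) then 1 else 0 : ZMod 2) = x₄
    revert q x₁ x₂ x₃ x₄
    decide)
  let r : G.Walk s t := (p.takeUntil a ha).append
    ((SimpleGraph.Walk.cons hab q).append (p.dropUntil a ha))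
  have hr : edgeCount r = edgeCount p + (edgeCount q + Pi.single (mkEdge hab) 1) := by
    conv_rhs => rw [← p.take_spec ha]
    simp only [r, edgeCount_append, edgeCount_cons]
    abel
  have hrle : ∀ e, edgeCount r e ≤ (edgeCount p + (R' + Pi.single (mkEdge hab) 1) : G.edgeSet → ℕ) e := by
    intro e
    rw [hr]
    simp only [Pi.add_apply]
    have := hq e
    omega
  have h1 := hmin ⟨r, hrle⟩
  have h2 : ∑ e, edgeCount r e ≤ ∑ e, (edgeCount p + (R' + Pi.single (mkEdge hab) 1) : G.edgeSet → ℕ) e :=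
    Finset.sum_le_sum fun e _ => hrle e
  have h3 : ∑ e, edgeCount p e + 1 ≤ ∑ e, edgeCount r e := by
    rw [hr]
    simp only [Pi.add_apply, Finset.sum_add_distrib, Finset.sum_pi_single', Finset.mem_univ,
      if_true]
    omega
  simp only [F] at h1
  omega

end Trails

/-! ### Shortest-path distances and shortcutting. -/

section Metric

variable {V : Type*} {H : SimpleGraph V} {c' : H.edgeSet → ℝ}

theorem metricCost_mkEdge {a b : V} (h : (⊤ : SimpleGraph V).Adj a b) :
    metricCost c' (mkEdge h) = shortestDist c' a b :=
  rfl

theorem shortestDist_le_walkCost (hc : ∀ e, 0 ≤ c' e) {u v : V} (p : H.Walk u v) :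
    shortestDist c' u v ≤ walkCost c' p :=
  ciInf_le ⟨0, by rintro _ ⟨q, rfl⟩; exact walkCost_nonneg hc q⟩ p

theorem shortestDist_nonneg (hc : ∀ e, 0 ≤ c' e) (u v : V) : 0 ≤ shortestDist c' u v :=
  Real.iInf_nonneg fun p => walkCost_nonneg hc p

theorem metricCost_nonneg (hc : ∀ e, 0 ≤ c' e) (e : (⊤ : SimpleGraph V).edgeSet) :
    0 ≤ metricCost c' e := by
  obtain ⟨a, b, h, rfl⟩ := exists_edge_eq_mkEdge e
  exact shortestDist_nonneg hc a b

theorem exists_walkCost_eq_shortestDist [Finite V] (hH : H.Connected) (hc : ∀ e, 0 ≤ c' e)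
    (u v : V) : ∃ p : H.Walk u v, walkCost c' p = shortestDist c' u v := by
  classical
  have := Fintype.ofFinite H.edgeSet
  have : Nonempty (H.Walk u v) := hH.preconnected u v
  obtain ⟨p, hp⟩ := exists_min_cost c' hc (fun p : H.Walk u v => edgeCount p)
  refine ⟨p, le_antisymm (le_ciInf fun q => ?_) (shortestDist_le_walkCost hc p)⟩
  rw [walkCost_eq_cost, walkCost_eq_cost, cost_eq_sum, cost_eq_sum]
  exact hp q

theorem shortestDist_triangle [Finite V] (hH : H.Connected) (hc : ∀ e, 0 ≤ c' e) (u v w : V) :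
    shortestDist c' u w ≤ shortestDist c' u v + shortestDist c' v w := by
  obtain ⟨p, hp⟩ := exists_walkCost_eq_shortestDist hH hc u v
  obtain ⟨q, hq⟩ := exists_walkCost_eq_shortestDist hH hc v w
  rw [← hp, ← hq, ← walkCost_append]
  exact shortestDist_le_walkCost hc _

/-- Induction along the walk: `A` holds the vertices already visited, `a` is the last of them, and
`u` is the current position. The term `shortestDist c' a u` is the cost of walk steps skipped so
far. Keeping `t` outside `A` postpones its visit to the end. -/
theorem exists_path_shortcut [Finite V] (hH : H.Connected) (hc : ∀ e, 0 ≤ c' e) {u t : V}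
    (q : H.Walk u t) (a : V) (A : Set V) (ha : a ∈ A) (ht : t ∉ A) :
    ∃ p : (⊤ : SimpleGraph V).Walk a t, p.IsPath ∧ (∀ x ∈ q.support, x ∉ A → x ∈ p.support) ∧
      (∀ x ∈ p.support, x = a ∨ x ∉ A) ∧
      walkCost (metricCost c') p ≤ shortestDist c' a u + walkCost c' q := by
  induction q generalizing a A with
  | @nil t =>
    have hat : (⊤ : SimpleGraph V).Adj a t := by
      rw [SimpleGraph.top_adj]
      rintro rfl
      exact ht ha
    refine ⟨SimpleGraph.Walk.cons hat SimpleGraph.Walk.nil, ?_, ?_, ?_, ?_⟩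
    · simpa using hat.ne
    · simp
    · simp [ht]
    · rw [walkCost_cons, metricCost_mkEdge, walkCost_nil, walkCost_nil]
  | @cons u b t h q ih =>
    have hstep : ∀ x, shortestDist c' x b ≤ shortestDist c' x u + c' (mkEdge h) := by
      intro x
      refine (shortestDist_triangle hH hc x u b).trans (add_le_add le_rfl ?_)
      have := shortestDist_le_walkCost hc (SimpleGraph.Walk.cons h SimpleGraph.Walk.nil)
      rwa [walkCost_cons, walkCost_nil, add_zero] at this
    by_cases hu : u ∈ A ∨ u = t
    · obtain ⟨p, h1, h2, h3, h4⟩ := ih a A ha ht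
      refine ⟨p, h1, ?_, h3, ?_⟩
      · intro x hx hxA
        rw [SimpleGraph.Walk.support_cons, List.mem_cons] at hx
        rcases hx with rfl | hx
        · rcases hu with hu | rfl
          · exact absurd hu hxA
          · exact p.end_mem_support
        · exact h2 x hx hxA
      · rw [walkCost_cons]
        have := hstep a
        linarith
    · push Not at hu
      obtain ⟨p, h1, h2, h3, h4⟩ := ih u (insert u A) (Set.mem_insert _ _) (by
        rw [Set.mem_insert_iff, not_or]
        exact ⟨hu.2.symm, ht⟩)
      have hau : (⊤ : SimpleGraph V).Adj a u := by
        rw [SimpleGraph.top_adj]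
        rintro rfl
        exact hu.1 ha
      refine ⟨SimpleGraph.Walk.cons hau p, ?_, ?_, ?_, ?_⟩
      · rw [SimpleGraph.Walk.cons_isPath_iff]
        refine ⟨h1, fun hap => ?_⟩
        rcases h3 a hap with h | h
        · exact hau.ne h
        · exact h (Set.mem_insert_of_mem _ ha)
      · intro x hx hxA
        rw [SimpleGraph.Walk.support_cons, List.mem_cons] at hx ⊢
        rcases hx with rfl | hx
        · exact Or.inr p.start_mem_support
        · by_cases hxu : x = u
          · exact Or.inr (hxu ▸ p.start_mem_support)
          · exact Or.inr (h2 x hx (by simp [hxu, hxA]))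
      · intro x hx
        rw [SimpleGraph.Walk.support_cons, List.mem_cons] at hx
        rcases hx with rfl | hx
        · exact Or.inl rfl
        · rcases h3 x hx with rfl | h
          · exact Or.inr hu.1
          · exact Or.inr fun h' => h (Set.mem_insert_of_mem _ h')
      · rw [walkCost_cons, walkCost_cons, metricCost_mkEdge]
        have := hstep u
        have h0 : shortestDist c' u u ≤ 0 := by
          have := shortestDist_le_walkCost hc (SimpleGraph.Walk.nil : H.Walk u u)
          rwa [walkCost_nil] at this
        linarith

/-- A spanning walk can be shortcut to a Hamiltonian path of the metric completion. -/
theorem exists_hamiltonian_path_le [Finite V] (hH : H.Connected) (hc : ∀ e, 0 ≤ c' e) {s t : V}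
    (hst : s ≠ t) (q : H.Walk s t) (hq : ∀ x, x ∈ q.support) :
    ∃ p : (⊤ : SimpleGraph V).Walk s t, p.IsPath ∧ (∀ x, x ∈ p.support) ∧
      walkCost (metricCost c') p ≤ walkCost c' q := by
  obtain ⟨p, h1, h2, -, h4⟩ := exists_path_shortcut hH hc q s {s} rfl hst.symm
  refine ⟨p, h1, fun x => ?_, ?_⟩
  · by_cases hx : x = s
    · exact hx ▸ p.start_mem_support
    · exact h2 x (hq x) hx
  · have h0 := shortestDist_le_walkCost hc (SimpleGraph.Walk.nil : H.Walk s s)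
    rw [walkCost_nil] at h0
    linarith

end Metric

/-! ### Hamiltonian paths as feasible vectors. -/

section PathVector

variable {V : Type*} [Fintype V] [DecidableEq V] {G : SimpleGraph V}

theorem sum_delta_singleton_edgeCount_eq_zero {u w v : V} (p : G.Walk u w) (hv : v ∉ p.support) :
    ∑ e ∈ delta G {v}, edgeCount p e = 0 := by
  refine Finset.sum_eq_zero fun e he => ?_
  obtain ⟨b, h, rfl⟩ := exists_adj_of_mem_delta_singleton he
  rw [edgeCount, coe_mkEdge, List.count_eq_zero]
  exact fun hmem => hv (p.fst_mem_support_of_mem_edges hmem)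

theorem sum_delta_start_edgeCount_le_one {u w : V} (p : G.Walk u w) (hp : p.IsPath) :
    ∑ e ∈ delta G {u}, edgeCount p e ≤ 1 := by
  cases p with
  | nil => simp [edgeCount_nil]
  | cons h p =>
    rw [SimpleGraph.Walk.cons_isPath_iff] at hp
    rw [sum_delta_edgeCount_cons, sum_delta_singleton_edgeCount_eq_zero p hp.2]
    split_ifs <;> simp

theorem sum_delta_end_edgeCount_le_one {u w : V} (p : G.Walk u w) (hp : p.IsPath) :
    ∑ e ∈ delta G {w}, edgeCount p e ≤ 1 := by
  have h := sum_delta_start_edgeCount_le_one p.reverse hp.reverse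
  rwa [edgeCount_reverse] at h

theorem sum_delta_singleton_edgeCount_le_two {u w : V} (p : G.Walk u w) (hp : p.IsPath) (v : V) :
    ∑ e ∈ delta G {v}, edgeCount p e ≤ 2 := by
  induction p with
  | nil => simp [edgeCount_nil]
  | @cons u b w h p ih =>
    rw [SimpleGraph.Walk.cons_isPath_iff] at hp
    rw [sum_delta_edgeCount_cons]
    by_cases hvu : v = u
    · subst hvu
      rw [sum_delta_singleton_edgeCount_eq_zero p hp.2]
      split_ifs <;> simp
    by_cases hvb : v = b
    · subst hvb
      have := sum_delta_start_edgeCount_le_one p hp.1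
      split_ifs <;> omega
    · have h1 : mkEdge h ∉ delta G {v} := by
        rw [mkEdge_mem_delta]
        simp [Ne.symm hvu, Ne.symm hvb]
      rw [if_neg h1]
      exact ih hp.1

/-- A spanning walk crosses every proper cut, and by parity at least twice if the cut does not
separate `s` from `t`. Being a path gives the upper bounds on degrees and entries. -/
theorem LP1Feasible.of_hamiltonian_path {s t : V} (hst : s ≠ t)
    (p : (⊤ : SimpleGraph V).Walk s t) (hp : p.IsPath) (hspan : ∀ x, x ∈ p.support) :
    LP1Feasible s t fun e => (edgeCount p e : ℝ) := by
  have hpos : ∀ S : Finset V, S.Nonempty → S ≠ Finset.univ →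
      1 ≤ ∑ e ∈ delta ⊤ S, edgeCount p e := by
    rintro S ⟨a, ha⟩ hS
    obtain ⟨b, hb⟩ : ∃ b, b ∉ S := by
      by_contra! h
      exact hS (Finset.eq_univ_iff_forall.2 h)
    exact one_le_sum_delta_edgeCount p (hspan a) (hspan b) ha hb
  have hpar : ∀ S : Finset V, ((∑ e ∈ delta ⊤ S, edgeCount p e : ℕ) : ZMod 2) =
      ((S ∩ {s, t}).card : ZMod 2) := by
    intro S
    rw [sum_delta_edgeCount_zmod, card_inter_pair_zmod S hst]
  have heven : ∀ S : Finset V, S.Nonempty → S ≠ Finset.univ → Even (S ∩ {s, t}).card →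
      2 ≤ ∑ e ∈ delta ⊤ S, edgeCount p e := by
    intro S h1 h2 h3
    have h4 := hpos S h1 h2
    have h5 := hpar S
    rw [natCast_zmod_two_eq_zero_iff.2 h3, natCast_zmod_two_eq_zero_iff] at h5
    rcases h5 with ⟨k, hk⟩
    omega
  have hsingle : ∀ v : V, ({v} : Finset V) ≠ Finset.univ := by
    intro v h
    have h1 := Finset.mem_univ s
    have h2 := Finset.mem_univ t
    rw [← h, Finset.mem_singleton] at h1 h2
    exact hst (h1.trans h2.symm)
  constructor
  · exact_mod_cast le_antisymm (sum_delta_start_edgeCount_le_one p hp)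
      (hpos {s} (Finset.singleton_nonempty s) (hsingle s))
  · exact_mod_cast le_antisymm (sum_delta_end_edgeCount_le_one p hp)
      (hpos {t} (Finset.singleton_nonempty t) (hsingle t))
  · intro v hvs hvt
    have h : Even (({v} : Finset V) ∩ {s, t}).card := by
      rw [Finset.singleton_inter_of_notMem (by simp [hvs, hvt])]
      simp
    exact_mod_cast le_antisymm (sum_delta_singleton_edgeCount_le_two p hp v)
      (heven {v} (Finset.singleton_nonempty v) (hsingle v) h)
  · intro S h1 h2 _
    exact_mod_cast hpos S h1 h2
  · intro S h1 h2 h3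
    exact_mod_cast heven S h1 h2 h3
  · exact fun e => Nat.cast_nonneg _
  · intro e
    have : edgeCount p e ≤ 1 := List.nodup_iff_count_le_one.1 hp.isTrail.edges_nodup _
    exact_mod_cast this

end PathVector

/-! ### The two inequalities and the existence of minima. -/

section Comparison

variable {V : Type*} [Fintype V] [DecidableEq V] {H : SimpleGraph V} {c' : H.edgeSet → ℝ}
  {s t : V}

theorem exists_nat_of_isIntegral {E : Type*} {G : SimpleGraph E} {x : G.edgeSet → ℝ}
    (hx : ∀ e, 0 ≤ x e) (hint : IsIntegral x) : ∃ X : G.edgeSet → ℕ, x = fun e => (X e : ℝ) := by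
  have h : ∀ e, ∃ n : ℕ, x e = n := by
    intro e
    obtain ⟨k, hk⟩ := hint e
    have h0 := hx e
    rw [hk] at h0
    obtain ⟨n, rfl⟩ := Int.eq_ofNat_of_zero_le (by exact_mod_cast h0 : (0 : ℤ) ≤ k)
    exact ⟨n, by simpa using hk⟩
  choose X hX using h
  exact ⟨X, funext hX⟩

theorem isIntegral_natCast {E : Type*} {G : SimpleGraph E} (X : G.edgeSet → ℕ) :
    IsIntegral fun e => (X e : ℝ) :=
  fun e => ⟨X e, by simp⟩

/-- Replacing every edge of the metric completion by a shortest path keeps the cost, does not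
decrease any cut, and keeps the parity of all cuts. -/
theorem exists_expansion (hH : H.Connected) (hc : ∀ e, 0 ≤ c' e)
    (X : (⊤ : SimpleGraph V).edgeSet → ℕ) :
    ∃ Y : H.edgeSet → ℕ,
      cost c' (fun e => (Y e : ℝ)) = cost (metricCost c') (fun e => (X e : ℝ)) ∧
      ∀ S : Finset V, ∑ e ∈ delta ⊤ S, X e ≤ ∑ e ∈ delta H S, Y e ∧
        ((∑ e ∈ delta H S, Y e : ℕ) : ZMod 2) = ((∑ e ∈ delta ⊤ S, X e : ℕ) : ZMod 2) := by
  classical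
  have := Fintype.ofFinite H.edgeSet
  choose a b h heq using fun e : (⊤ : SimpleGraph V).edgeSet => exists_edge_eq_mkEdge e
  choose p hp using fun e : (⊤ : SimpleGraph V).edgeSet =>
    exists_walkCost_eq_shortestDist hH hc (a e) (b e)
  refine ⟨fun f => ∑ e, X e * edgeCount (p e) f, ?_, fun S => ?_⟩
  · rw [cost_eq_sum, cost_eq_sum]
    push_cast
    simp only [Finset.mul_sum]
    rw [Finset.sum_comm]
    refine Finset.sum_congr rfl fun e _ => ?_
    have h1 : metricCost c' e = walkCost c' (p e) := by
      rw [hp e]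
      exact (congrArg (metricCost c') (heq e)).trans (metricCost_mkEdge _)
    rw [h1, walkCost_eq_cost, cost_eq_sum, Finset.sum_mul]
    exact Finset.sum_congr rfl fun f _ => by ring
  · have h1 : ∑ f ∈ delta H S, ∑ e, X e * edgeCount (p e) f =
        ∑ e, X e * ∑ f ∈ delta H S, edgeCount (p e) f := by
      rw [Finset.sum_comm]
      simp only [Finset.mul_sum]
    have h2 : ∑ e ∈ delta ⊤ S, X e = ∑ e, X e * (if e ∈ delta ⊤ S then 1 else 0) := by
      simp [Finset.sum_ite_mem]
    have h3 : ∀ e, (if e ∈ delta ⊤ S then 1 else 0 : ZMod 2) =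
        ((∑ f ∈ delta H S, edgeCount (p e) f : ℕ) : ZMod 2) := by
      intro e
      rw [sum_delta_edgeCount_zmod, ← ite_mem_delta_zmod S (h e), ← heq e]
    rw [h1, h2]
    constructor
    · refine Finset.sum_le_sum fun e _ => Nat.mul_le_mul_left _ ?_
      by_cases he : e ∈ delta ⊤ S
      · have h4 := h3 e
        -- The path replacing an edge of the cut crosses the cut an odd number of times, hence at
        -- least once.
        rw [if_pos he] at h4 ⊢
        by_contra hlt
        rw [Nat.lt_one_iff.1 (not_le.1 hlt)] at h4
        exact one_ne_zero h4
      · simp [he]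
    · push_cast
      refine Finset.sum_congr rfl fun e _ => ?_
      rw [h3]
      push_cast
      rfl

theorem LP1Feasible.expansion {X : (⊤ : SimpleGraph V).edgeSet → ℕ}
    (hX : LP1Feasible s t fun e => (X e : ℝ)) {Y : H.edgeSet → ℕ}
    (hY : ∀ S : Finset V, ∑ e ∈ delta ⊤ S, X e ≤ ∑ e ∈ delta H S, Y e) :
    LP4Feasible H s t fun e => (Y e : ℝ) := by
  have hcut : ∀ S : Finset V, ∑ e ∈ delta ⊤ S, (X e : ℝ) ≤ ∑ e ∈ delta H S, (Y e : ℝ) := by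
    intro S
    exact_mod_cast hY S
  have heven : ∀ S : Finset V, S.Nonempty → S ≠ Finset.univ → Even (S ∩ {s, t}).card →
      2 ≤ ∑ e ∈ delta H S, (Y e : ℝ) :=
    fun S h1 h2 h3 => (hX.even_cut S h1 h2 h3).trans (hcut S)
  exact ⟨cut_partition (s := s) (t := t) (fun e => Nat.cast_nonneg _)
    (fun S h1 h2 h3 => (hX.st_cut S h1 h2 h3).trans (hcut S)) heven, heven,
    fun e => Nat.cast_nonneg _⟩

/-- The edges that make the degrees of an integral solution odd exactly at `s` and `t` cost at
most half of the solution. -/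
theorem LP4Feasible.exists_join [Fintype H.edgeSet] (hst : s ≠ t) (hc : ∀ e, 0 ≤ c' e)
    {Y : H.edgeSet → ℕ} (hY : LP4Feasible H s t fun e => (Y e : ℝ)) :
    ∃ J : H.edgeSet → ℕ, (∀ v : V, ((∑ e ∈ delta H {v}, (Y e + J e) : ℕ) : ZMod 2) =
        (if s ∈ ({v} : Finset V) then 1 else 0) + (if t ∈ ({v} : Finset V) then 1 else 0)) ∧
      cost c' (fun e => (J e : ℝ)) ≤ 1 / 2 * cost c' fun e => (Y e : ℝ) := by
  classical
  -- The parity by which the degree in `Y` differs from that of an `s`-`t` trail.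
  let τ : V → ZMod 2 := fun v => ((∑ e ∈ delta H {v}, Y e : ℕ) : ZMod 2) +
    ((if s ∈ ({v} : Finset V) then 1 else 0) + (if t ∈ ({v} : Finset V) then 1 else 0))
  obtain ⟨J, hJ, hJc⟩ := exists_join_le_half
    (fun (e : H.edgeSet) (v : V) => if e ∈ delta H {v} then (1 : ZMod 2) else 0) Y τ c' hc (by
    intro f hf
    let S : Finset V := Finset.univ.filter fun v => f v ≠ 0
    have hfS : ∀ g : V → ZMod 2, ∑ v, f v * g v = ∑ v ∈ S, g v := by
      intro g
      rw [Finset.sum_filter]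
      refine Finset.sum_congr rfl fun v _ => ?_
      by_cases hv : f v = 0
      · simp [hv]
      · rw [if_pos hv, zmod_two_eq_one hv, one_mul]
    have hδ : (Finset.univ.filter fun e : H.edgeSet =>
        ∑ v, f v * (if e ∈ delta H {v} then (1 : ZMod 2) else 0) ≠ 0) = delta H S := by
      ext e
      rw [Finset.mem_filter, hfS, ← ite_mem_delta_eq_sum]
      simp
    rw [hδ]
    have hτ : ∑ v ∈ S, τ v = ((∑ e ∈ delta H S, Y e : ℕ) : ZMod 2) +
        ((S ∩ {s, t}).card : ZMod 2) := by
      rw [sum_delta_zmod_eq, card_inter_pair_zmod S hst, Finset.sum_add_distrib,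
        Finset.sum_add_distrib]
      simp only [Finset.mem_singleton, Finset.sum_ite_eq]
    rw [hfS, hτ] at hf
    have hS1 : S.Nonempty := by
      rw [Finset.nonempty_iff_ne_empty]
      intro h0
      rw [h0] at hf
      simp [delta] at hf
    have hS2 : S ≠ Finset.univ := by
      intro h1
      rw [h1, delta_univ, card_inter_pair_zmod _ hst] at hf
      exact hf (by simp; decide)
    -- Here `Y(δ(S)) + |S ∩ {s, t}|` is odd. If the cut separates `s` from `t`, its weight is even
    -- and, by the partition constraint, positive.
    by_cases hev : Even (S ∩ {s, t}).card
    · exact_mod_cast hY.even_cut S hS1 hS2 hev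
    · have h1 : 1 ≤ ∑ e ∈ delta H S, Y e := by exact_mod_cast hY.one_le_cut hS1 hS2
      have h2 : ((S ∩ {s, t}).card : ZMod 2) = 1 :=
        zmod_two_eq_one fun h => hev (natCast_zmod_two_eq_zero_iff.1 h)
      have h3 : Even (∑ e ∈ delta H S, Y e) := by
        rw [← natCast_zmod_two_eq_zero_iff]
        rw [h2] at hf
        revert hf
        generalize ((∑ e ∈ delta H S, Y e : ℕ) : ZMod 2) = q
        revert q
        decide
      obtain ⟨k, hk⟩ := h3
      omega)
  refine ⟨J, fun v => ?_, ?_⟩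
  · have h1 := hJ v
    have h2 : ((∑ e ∈ delta H {v}, J e : ℕ) : ZMod 2) = τ v := by
      rw [← h1]
      simp
    rw [Finset.sum_add_distrib, Nat.cast_add, h2]
    simp only [τ]
    rw [← add_assoc, CharTwo.add_self_eq_zero, zero_add]
  · rw [cost_eq_sum, cost_eq_sum]
    exact hJc

theorem LP4Feasible.exists_LP1Feasible_le (hH : H.Connected) (hc : ∀ e, 0 ≤ c' e) (hst : s ≠ t)
    {Y : H.edgeSet → ℕ} (hY : LP4Feasible H s t fun e => (Y e : ℝ)) :
    ∃ X : (⊤ : SimpleGraph V).edgeSet → ℕ, LP1Feasible s t (fun e => (X e : ℝ)) ∧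
      cost (metricCost c') (fun e => (X e : ℝ)) ≤ 3 / 2 * cost c' fun e => (Y e : ℝ) := by
  classical
  have := Fintype.ofFinite H.edgeSet
  obtain ⟨J, hJ, hJc⟩ := hY.exists_join hst hc
  obtain ⟨q, hq, hqW⟩ := exists_spanning_walk_edgeCount_le (fun e => Y e + J e) s t hJ (by
    intro S h1 h2
    have h3 : 1 ≤ ∑ e ∈ delta H S, Y e := by exact_mod_cast hY.one_le_cut h1 h2
    exact h3.trans (Finset.sum_le_sum fun e _ => Nat.le_add_right _ _))
  obtain ⟨p, hp, hspan, hle⟩ := exists_hamiltonian_path_le hH hc hst q hq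
  refine ⟨edgeCount p, LP1Feasible.of_hamiltonian_path hst p hp hspan, ?_⟩
  rw [← walkCost_eq_cost]
  have h1 : walkCost c' q ≤ cost c' (fun e => (Y e : ℝ)) + cost c' (fun e => (J e : ℝ)) := by
    rw [walkCost_eq_cost, cost_eq_sum, cost_eq_sum, cost_eq_sum, ← Finset.sum_add_distrib]
    refine Finset.sum_le_sum fun e _ => ?_
    rw [← mul_add]
    exact mul_le_mul_of_nonneg_left (by exact_mod_cast hqW e) (hc e)
  linarith

theorem one_le_sum_delta_of_connected (hH : H.Connected) {Y : H.edgeSet → ℕ}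
    (hY : ∀ e, 1 ≤ Y e) {S : Finset V} (hS : S.Nonempty) (hS' : S ≠ Finset.univ) :
    1 ≤ ∑ e ∈ delta H S, Y e := by
  obtain ⟨a, ha⟩ := hS
  obtain ⟨b, hb⟩ : ∃ b, b ∉ S := by
    by_contra! h
    exact hS' (Finset.eq_univ_iff_forall.2 h)
  obtain ⟨p⟩ := hH.preconnected a b
  obtain ⟨e, he, -⟩ := Finset.exists_ne_zero_of_sum_ne_zero
    (Nat.one_le_iff_ne_zero.1 (one_le_sum_delta_edgeCount_of_ends p ha hb))
  exact (hY e).trans (Finset.single_le_sum (f := Y) (fun _ _ => Nat.zero_le _) he)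

theorem LP4Feasible.of_nat_cuts {Y : H.edgeSet → ℕ}
    (hY : ∀ S : Finset V, S.Nonempty → S ≠ Finset.univ → 2 ≤ ∑ e ∈ delta H S, Y e) :
    LP4Feasible H s t fun e => (Y e : ℝ) := by
  have h2 : ∀ S : Finset V, S.Nonempty → S ≠ Finset.univ → (2 : ℝ) ≤ ∑ e ∈ delta H S, (Y e : ℝ) :=
    fun S h h' => by exact_mod_cast hY S h h'
  exact ⟨cut_partition (s := s) (t := t) (fun e => Nat.cast_nonneg _)
    (fun S h h' _ => by linarith [h2 S h h']) (fun S h h' _ => h2 S h h'),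
    fun S h h' _ => h2 S h h', fun e => Nat.cast_nonneg _⟩

theorem exists_LP4Feasible (hH : H.Connected) (s t : V) :
    ∃ Y : H.edgeSet → ℕ, LP4Feasible H s t fun e => (Y e : ℝ) := by
  -- Doubling every edge of a connected graph makes every proper cut weigh at least 2.
  refine ⟨fun _ => 2, LP4Feasible.of_nat_cuts fun S h h' => ?_⟩
  have h1 := one_le_sum_delta_of_connected hH (Y := fun _ => 1) (fun _ => le_rfl) h h'
  rw [Finset.sum_const, smul_eq_mul] at h1 ⊢
  omega

/-- The integral solutions of a system attain their minimal cost. -/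
theorem isLeast_sInf_cost {E : Type*} [Finite E] {G : SimpleGraph E} {c : G.edgeSet → ℝ}
    (hc : ∀ e, 0 ≤ c e) {P : (G.edgeSet → ℝ) → Prop} (hP : ∀ x, P x → ∀ e, 0 ≤ x e)
    (hne : ∃ X : G.edgeSet → ℕ, P fun e => (X e : ℝ)) :
    IsLeast {r | ∃ x, P x ∧ IsIntegral x ∧ cost c x = r}
      (sInf {r | ∃ x, P x ∧ IsIntegral x ∧ cost c x = r}) := by
  have := Fintype.ofFinite G.edgeSet
  obtain ⟨X₀, hX₀⟩ := hne
  have : Nonempty {X : G.edgeSet → ℕ // P fun e => (X e : ℝ)} := ⟨⟨X₀, hX₀⟩⟩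
  obtain ⟨⟨X, hX⟩, hmin⟩ := exists_min_cost c hc
    (fun X : {X : G.edgeSet → ℕ // P fun e => (X e : ℝ)} => X.1)
  have hleast : IsLeast {r | ∃ x, P x ∧ IsIntegral x ∧ cost c x = r}
      (cost c fun e => (X e : ℝ)) := by
    refine ⟨⟨_, hX, isIntegral_natCast X, rfl⟩, ?_⟩
    rintro r ⟨x, hx, hint, rfl⟩
    obtain ⟨X', rfl⟩ := exists_nat_of_isIntegral (hP x hx) hint
    rw [cost_eq_sum, cost_eq_sum]
    exact hmin ⟨X', hx⟩
  rwa [hleast.csInf_eq]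

theorem isLeast_optInt4 (hH : H.Connected) (hc : ∀ e, 0 ≤ c' e) (s t : V) :
    IsLeast (intCosts4 c' s t) (optInt4 c' s t) :=
  isLeast_sInf_cost hc (fun _ hx => hx.nonneg) (exists_LP4Feasible hH s t)

theorem isLeast_optInt1 (hH : H.Connected) (hc : ∀ e, 0 ≤ c' e) (hst : s ≠ t) :
    IsLeast (intCosts1 c' s t) (optInt1 c' s t) := by
  refine isLeast_sInf_cost (metricCost_nonneg hc) (fun _ hx => hx.nonneg) ?_
  obtain ⟨Y, hY⟩ := exists_LP4Feasible hH s t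
  obtain ⟨X, hX, -⟩ := hY.exists_LP1Feasible_le hH hc hst
  exact ⟨X, hX⟩

theorem optInt4_le_optInt1 (hH : H.Connected) (hc : ∀ e, 0 ≤ c' e) (hst : s ≠ t) :
    optInt4 c' s t ≤ optInt1 c' s t := by
  obtain ⟨x, hx, hint, hcost⟩ := (isLeast_optInt1 hH hc hst).1
  obtain ⟨X, rfl⟩ := exists_nat_of_isIntegral hx.nonneg hint
  obtain ⟨Y, hYc, hY⟩ := exists_expansion hH hc X
  rw [← hcost, ← hYc]
  exact (isLeast_optInt4 hH hc s t).2
    ⟨_, hx.expansion fun S => (hY S).1, isIntegral_natCast Y, rfl⟩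

theorem optInt1_le (hH : H.Connected) (hc : ∀ e, 0 ≤ c' e) (hst : s ≠ t) :
    optInt1 c' s t ≤ 3 / 2 * optInt4 c' s t := by
  obtain ⟨y, hy, hint, hcost⟩ := (isLeast_optInt4 hH hc s t).1
  obtain ⟨Y, rfl⟩ := exists_nat_of_isIntegral hy.nonneg hint
  obtain ⟨X, hX, hle⟩ := hy.exists_LP1Feasible_le hH hc hst
  rw [← hcost]
  exact ((isLeast_optInt1 hH hc hst).2 ⟨_, hX, isIntegral_natCast X, rfl⟩).trans hle

end Comparison

/-! ### Unit costs and the complete graph. -/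

section UnitCosts

variable {V : Type*} [Fintype V] [DecidableEq V] {H : SimpleGraph V} {s t : V}

/-- The partition into singletons. -/
theorem LP4Feasible.card_sub_one_le_cost {x : H.edgeSet → ℝ} (hx : LP4Feasible H s t x) :
    (Fintype.card V : ℝ) - 1 ≤ cost (fun _ => 1) x := by
  have := Fintype.ofFinite H.edgeSet
  have h := hx.partition ⊥
  rw [Finpartition.card_bot, Finset.card_univ] at h
  refine h.trans ?_
  rw [cost_eq_sum]
  simp only [one_mul]
  exact Finset.sum_le_sum_of_subset_of_nonneg (Finset.subset_univ _) fun e _ _ => hx.nonneg e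

theorem card_sub_one_le_optInt4 (hH : H.Connected) (s t : V) :
    (Fintype.card V : ℝ) - 1 ≤ optInt4 (fun _ : H.edgeSet => (1 : ℝ)) s t := by
  obtain ⟨x, hx, -, hcost⟩ := (isLeast_optInt4 hH (fun _ => zero_le_one) s t).1
  rw [← hcost]
  exact hx.card_sub_one_le_cost

theorem sum_degrees_eq_two_mul_sum [Fintype H.edgeSet] (x : H.edgeSet → ℝ) :
    ∑ v, ∑ e ∈ delta H {v}, x e = 2 * ∑ e, x e := by
  have h1 : ∀ v, ∑ e ∈ delta H {v}, x e = ∑ e, if e ∈ delta H {v} then x e else 0 := by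
    intro v
    rw [Finset.sum_ite_mem, Finset.univ_inter]
  simp only [h1]
  rw [Finset.sum_comm, Finset.mul_sum]
  refine Finset.sum_congr rfl fun e _ => ?_
  obtain ⟨a, b, h, rfl⟩ := exists_edge_eq_mkEdge e
  have h2 : (Finset.univ.filter fun v => mkEdge h ∈ delta H {v}) = {a, b} := by
    ext v
    have hne := h.ne
    simp only [Finset.mem_filter, Finset.mem_univ, true_and, mkEdge_mem_delta,
      Finset.mem_singleton, Finset.mem_insert]
    constructor
    · rintro (⟨rfl, -⟩ | ⟨rfl, -⟩) <;> simp
    · rintro (rfl | rfl)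
      · exact Or.inl ⟨rfl, hne.symm⟩
      · exact Or.inr ⟨rfl, hne⟩
  rw [← Finset.sum_filter, h2, Finset.sum_const, Finset.card_pair h.ne, nsmul_eq_mul]
  norm_num

/-- The degree equations add up to `2n - 2`, which counts every edge twice. -/
theorem LP1Feasible.sum_eq [Fintype (⊤ : SimpleGraph V).edgeSet] (hst : s ≠ t)
    {x : (⊤ : SimpleGraph V).edgeSet → ℝ} (hx : LP1Feasible s t x) :
    ∑ e, x e = Fintype.card V - 1 := by
  have h1 := sum_degrees_eq_two_mul_sum x
  have h2 : ∀ v, ∑ e ∈ delta ⊤ {v}, x e =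
      2 - (if v = s then 1 else 0) - (if v = t then 1 else 0) := by
    intro v
    by_cases hvs : v = s
    · subst hvs
      rw [hx.degree_s]
      norm_num [hst]
    by_cases hvt : v = t
    · subst hvt
      rw [hx.degree_t]
      norm_num [hvs]
    · rw [hx.degree v hvs hvt]
      norm_num [hvs, hvt]
  simp only [h2, Finset.sum_sub_distrib, Finset.sum_const, Finset.card_univ, nsmul_eq_mul,
    Finset.sum_ite_eq', Finset.mem_univ, if_true] at h1
  linarith

theorem optInt1_top_le (hst : s ≠ t) :
    optInt1 (fun _ : (⊤ : SimpleGraph V).edgeSet => (1 : ℝ)) s t ≤ Fintype.card V - 1 := by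
  have := Fintype.ofFinite (⊤ : SimpleGraph V).edgeSet
  have : Nonempty V := ⟨s⟩
  obtain ⟨x, hx, -, hcost⟩ := (isLeast_optInt1 (H := (⊤ : SimpleGraph V)) (c' := fun _ => 1)
    SimpleGraph.connected_top (fun _ => zero_le_one) hst).1
  rw [← hcost, ← hx.sum_eq hst, cost_eq_sum]
  refine Finset.sum_le_sum fun e _ => mul_le_of_le_one_left (hx.nonneg e) ?_
  obtain ⟨a, b, h, rfl⟩ := exists_edge_eq_mkEdge e
  rw [metricCost_mkEdge]
  have := shortestDist_le_walkCost (c' := fun _ => (1 : ℝ)) (fun _ => zero_le_one)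
    (SimpleGraph.Walk.cons h SimpleGraph.Walk.nil)
  rwa [walkCost_cons, walkCost_nil, add_zero] at this

/-- For the complete graph both optimal values with unit costs are equal. -/
theorem optInt_top_eq (hst : s ≠ t) :
    0 < optInt4 (fun _ : (⊤ : SimpleGraph V).edgeSet => (1 : ℝ)) s t ∧
      optInt4 (fun _ : (⊤ : SimpleGraph V).edgeSet => (1 : ℝ)) s t =
        optInt1 (fun _ : (⊤ : SimpleGraph V).edgeSet => (1 : ℝ)) s t := by
  have : Nonempty V := ⟨s⟩
  have h1 := card_sub_one_le_optInt4 (SimpleGraph.connected_top (V := V)) s t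
  have h2 := optInt4_le_optInt1 (H := (⊤ : SimpleGraph V)) (c' := fun _ => 1)
    SimpleGraph.connected_top (fun _ => zero_le_one) hst
  have h3 := optInt1_top_le hst
  have h4 : (1 : ℝ) < Fintype.card V := by
    exact_mod_cast Fintype.one_lt_card_iff.2 ⟨s, t, hst⟩
  exact ⟨by linarith, le_antisymm h2 (h3.trans h1)⟩

/-- For integral vectors the degree equations alone determine the parity of every cut. -/
theorem LP1Feasible.sum_delta_zmod (hst : s ≠ t) {X : (⊤ : SimpleGraph V).edgeSet → ℕ}
    (hX : LP1Feasible s t fun e => (X e : ℝ)) (S : Finset V) :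
    ((∑ e ∈ delta ⊤ S, X e : ℕ) : ZMod 2) =
      (if s ∈ S then 1 else 0) + (if t ∈ S then 1 else 0) := by
  rw [sum_delta_zmod_eq]
  have h : ∀ v, ((∑ e ∈ delta ⊤ {v}, X e : ℕ) : ZMod 2) =
      (if v = s then 1 else 0) + (if v = t then 1 else 0) := by
    intro v
    by_cases hvs : v = s
    · subst hvs
      have : ∑ e ∈ delta ⊤ {v}, X e = 1 := by exact_mod_cast hX.degree_s
      simp [this, hst]
    by_cases hvt : v = t
    · subst hvt
      have : ∑ e ∈ delta ⊤ {v}, X e = 1 := by exact_mod_cast hX.degree_t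
      simp [this, hvs]
    · have : ∑ e ∈ delta ⊤ {v}, X e = 2 := by exact_mod_cast hX.degree v hvs hvt
      rw [this]
      simp [hvs, hvt]
      decide
  simp only [h, Finset.sum_add_distrib, Finset.sum_ite_eq']

end UnitCosts

/-! ### Even cycles with antipodal ends. -/

section Cycle

/-- At most one value is zero, and every other value is even and positive, hence at least 2. -/
theorem two_mul_card_le_sum_add_two {ι : Type*} {B : Finset ι} {Y : ι → ℕ}
    (heven : ∀ i ∈ B, Even (Y i)) (h2 : ∀ i ∈ B, ∀ j ∈ B, i ≠ j → 2 ≤ Y i + Y j) :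
    2 * B.card ≤ ∑ i ∈ B, Y i + 2 := by
  classical
  by_cases h0 : ∃ i ∈ B, Y i = 0
  · obtain ⟨i, hi, hYi⟩ := h0
    have h : ∑ j ∈ B.erase i, 2 ≤ ∑ j ∈ B.erase i, Y j := by
      refine Finset.sum_le_sum fun j hj => ?_
      have := h2 i hi j (Finset.mem_of_mem_erase hj) (Finset.ne_of_mem_erase hj).symm
      omega
    rw [Finset.sum_const, smul_eq_mul, Finset.card_erase_of_mem hi] at h
    rw [← Finset.add_sum_erase B Y hi]
    omega
  · push Not at h0
    have h : ∑ j ∈ B, 2 ≤ ∑ j ∈ B, Y j := by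
      refine Finset.sum_le_sum fun j hj => ?_
      obtain ⟨r, hr⟩ := heven j hj
      have := h0 j hj
      omega
    rw [Finset.sum_const, smul_eq_mul] at h
    omega

theorem card_add_two_mul_card_le {ι : Type*} {A B : Finset ι} {Y : ι → ℕ}
    (hA : ∀ i ∈ A, Odd (Y i)) (hB : ∀ i ∈ B, Even (Y i))
    (h2 : ∀ i ∈ B, ∀ j ∈ B, i ≠ j → 2 ≤ Y i + Y j) :
    A.card + 2 * B.card ≤ ∑ i ∈ A, Y i + ∑ i ∈ B, Y i + 2 := by
  have h1 : ∑ i ∈ A, 1 ≤ ∑ i ∈ A, Y i := Finset.sum_le_sum fun i hi => (hA i hi).pos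
  rw [Finset.sum_const, smul_eq_mul, mul_one] at h1
  have := two_mul_card_le_sum_add_two hB h2
  omega

/-- Odd cross sums force one of the two families to be entirely odd and the other entirely even. The
odd one contributes at least `k`, the even one at least `2k - 2`. -/
theorem three_mul_le_of_odd_cross {ι : Type*} {A B : Finset ι} {Y : ι → ℕ} {k : ℕ}
    (hAk : A.card = k) (hBk : B.card = k) (hk : 0 < k)
    (hodd : ∀ i ∈ A, ∀ j ∈ B, Odd (Y i + Y j))
    (hA : ∀ i ∈ A, ∀ j ∈ A, i ≠ j → 2 ≤ Y i + Y j)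
    (hB : ∀ i ∈ B, ∀ j ∈ B, i ≠ j → 2 ≤ Y i + Y j) :
    3 * k ≤ ∑ i ∈ A, Y i + ∑ i ∈ B, Y i + 2 := by
  obtain ⟨a, ha⟩ : A.Nonempty := Finset.card_pos.1 (hAk ▸ hk)
  obtain ⟨b, hb⟩ : B.Nonempty := Finset.card_pos.1 (hBk ▸ hk)
  rcases Nat.even_or_odd (Y a) with h | h
  · have hBo : ∀ j ∈ B, Odd (Y j) := fun j hj => by
      have := hodd a ha j hj
      grind
    have hAe : ∀ i ∈ A, Even (Y i) := fun i hi => by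
      have := hodd i hi b hb
      have := hBo b hb
      grind
    have := card_add_two_mul_card_le hBo hAe hA
    omega
  · have hBe : ∀ j ∈ B, Even (Y j) := fun j hj => by
      have := hodd a ha j hj
      grind
    have hAo : ∀ i ∈ A, Odd (Y i) := fun i hi => by
      have := hodd i hi b hb
      have := hBe b hb
      grind
    have := card_add_two_mul_card_le hAo hBe hB
    omega

open SimpleGraph in
theorem cycleGraph_adj_add_one (m : ℕ) (i : Fin (2 * m + 4)) :
    (cycleGraph (2 * m + 4)).Adj i (i + 1) := by
  rw [cycleGraph_adj]
  exact Or.inr (add_sub_cancel_left i 1)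

/-- The edge of an even cycle from a vertex to the next one. -/
def cycleEdge (m : ℕ) (i : Fin (2 * m + 4)) : (SimpleGraph.cycleGraph (2 * m + 4)).edgeSet :=
  mkEdge (cycleGraph_adj_add_one m i)

theorem cycleEdge_bijective (m : ℕ) : Function.Bijective (cycleEdge m) := by
  constructor
  · intro i j hij
    have h : s(i, i + 1) = s(j, j + 1) := congrArg Subtype.val hij
    rcases Sym2.eq_iff.1 h with ⟨h1, -⟩ | ⟨h1, h2⟩
    · exact h1
    -- Coincidence with reversed ends would mean `2 = 0` modulo the length, which is at least 4.
    · exfalso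
      have h1 := congrArg Fin.val h1
      have h2 := congrArg Fin.val h2
      rw [Fin.val_add_one] at h1 h2
      simp only [Fin.ext_iff, Fin.val_last] at h1 h2
      split_ifs at h1 h2 <;> omega
  · intro e
    obtain ⟨a, b, h, rfl⟩ := exists_edge_eq_mkEdge e
    have hab := h
    rw [SimpleGraph.cycleGraph_adj, sub_eq_iff_eq_add', sub_eq_iff_eq_add'] at hab
    rcases hab with hab | hab
    · refine ⟨b, Subtype.ext ?_⟩
      rw [cycleEdge, coe_mkEdge, coe_mkEdge, hab, Sym2.eq_swap]
    · refine ⟨a, Subtype.ext ?_⟩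
      rw [cycleEdge, coe_mkEdge, coe_mkEdge, hab]

theorem sum_delta_cycleGraph {M : Type*} [AddCommMonoid M] (m : ℕ)
    (Y : (SimpleGraph.cycleGraph (2 * m + 4)).edgeSet → M) (S : Finset (Fin (2 * m + 4))) :
    ∑ e ∈ delta _ S, Y e = ∑ i with cycleEdge m i ∈ delta _ S, Y (cycleEdge m i) := by
  classical
  have := Fintype.ofFinite (SimpleGraph.cycleGraph (2 * m + 4)).edgeSet
  rw [Finset.sum_filter, (cycleEdge_bijective m).sum_comp
    (fun e => if e ∈ delta _ S then Y e else 0), Finset.sum_ite_mem, Finset.univ_inter]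

/-- Shifting the index shows that every cut of the cycle has even size, and connectedness makes it
nonempty, so it has at least two edges. -/
theorem LP4Feasible.cycleGraph_one (m : ℕ) (s t : Fin (2 * m + 4)) :
    LP4Feasible (SimpleGraph.cycleGraph (2 * m + 4)) s t fun _ => ((1 : ℕ) : ℝ) := by
  refine LP4Feasible.of_nat_cuts (Y := fun _ => 1) fun S h h' => ?_
  have h1 := one_le_sum_delta_of_connected (H := SimpleGraph.cycleGraph (2 * m + 4))
    SimpleGraph.cycleGraph_connected (Y := fun _ => 1) (fun _ => le_rfl) h h'
  have h2 : ((∑ e ∈ delta (SimpleGraph.cycleGraph (2 * m + 4)) S, 1 : ℕ) : ZMod 2) = 0 := by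
    rw [sum_delta_cycleGraph, Nat.cast_sum, Nat.cast_one, Finset.sum_filter]
    have h3 : ∀ i, (if cycleEdge m i ∈ delta _ S then 1 else 0 : ZMod 2) =
        (if i ∈ S then 1 else 0) + (if i + 1 ∈ S then 1 else 0) :=
      fun i => ite_mem_delta_zmod S (cycleGraph_adj_add_one m i)
    have h4 : ∑ i : Fin (2 * m + 4), (if i + 1 ∈ S then 1 else 0 : ZMod 2) =
        ∑ i, if i ∈ S then 1 else 0 :=
      Equiv.sum_comp (Equiv.addRight (1 : Fin (2 * m + 4))) (fun i => if i ∈ S then 1 else 0)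
    rw [Finset.sum_congr rfl fun i _ => h3 i, Finset.sum_add_distrib, h4]
    exact CharTwo.add_self_eq_zero _
  rw [natCast_zmod_two_eq_zero_iff] at h2
  obtain ⟨r, hr⟩ := h2
  omega

theorem optInt4_cycleGraph_le (m : ℕ) (s t : Fin (2 * m + 4)) :
    optInt4 (fun _ : (SimpleGraph.cycleGraph (2 * m + 4)).edgeSet => (1 : ℝ)) s t ≤
      2 * m + 4 := by
  have := Fintype.ofFinite (SimpleGraph.cycleGraph (2 * m + 4)).edgeSet
  refine (isLeast_optInt4 SimpleGraph.cycleGraph_connected (fun _ => zero_le_one) s t).2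
    ⟨_, LP4Feasible.cycleGraph_one m s t, isIntegral_natCast _, ?_⟩
  rw [cost_eq_sum, ← (cycleEdge_bijective m).sum_comp]
  simp

/-- The arc consists of the vertices `p + 1, …, q`. It avoids 0 and is bounded by the edge entering
`p + 1` and the edge leaving `q`, also when the latter wraps around to 0. -/
theorem mem_delta_arc_iff (m : ℕ) {p q : Fin (2 * m + 4)} (hpq : p < q) (i : Fin (2 * m + 4)) :
    cycleEdge m i ∈ delta _ (Finset.Ioc p q) ↔ i = p ∨ i = q := by
  rw [cycleEdge, mkEdge_mem_delta]
  simp only [Finset.mem_Ioc, Fin.lt_def, Fin.le_def, Fin.val_add_one, Fin.ext_iff, Fin.val_last]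
  have := p.2
  have := q.2
  have := i.2
  rw [Fin.lt_def] at hpq
  split_ifs <;> omega

theorem sum_delta_arc (m : ℕ) (Y : (SimpleGraph.cycleGraph (2 * m + 4)).edgeSet → ℕ)
    {p q : Fin (2 * m + 4)} (hpq : p < q) :
    ∑ e ∈ delta _ (Finset.Ioc p q), Y e = Y (cycleEdge m p) + Y (cycleEdge m q) := by
  have h : (Finset.univ.filter fun i => cycleEdge m i ∈ delta _ (Finset.Ioc p q)) = {p, q} := by
    ext i
    simp [mem_delta_arc_iff m hpq]
  rw [sum_delta_cycleGraph, h, Finset.sum_pair hpq.ne]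

theorem le_optInt1_cycleGraph (m : ℕ) {t : Fin (2 * m + 4)} (ht : (t : ℕ) = m + 2) :
    3 * ((m : ℝ) + 2) - 2 ≤
      optInt1 (fun _ : (SimpleGraph.cycleGraph (2 * m + 4)).edgeSet => (1 : ℝ)) 0 t := by
  have := Fintype.ofFinite (SimpleGraph.cycleGraph (2 * m + 4)).edgeSet
  have hst : (0 : Fin (2 * m + 4)) ≠ t := by
    intro h
    rw [← h] at ht
    simp at ht
  have hc : ∀ e : (SimpleGraph.cycleGraph (2 * m + 4)).edgeSet, (0 : ℝ) ≤ (fun _ => 1) e :=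
    fun _ => zero_le_one
  obtain ⟨x, hx, hint, hcost⟩ := (isLeast_optInt1 SimpleGraph.cycleGraph_connected hc hst).1
  obtain ⟨X, rfl⟩ := exists_nat_of_isIntegral hx.nonneg hint
  obtain ⟨Y, hYc, hY⟩ := exists_expansion SimpleGraph.cycleGraph_connected hc X
  have hfeas := hx.expansion fun S => (hY S).1
  have hpar : ∀ S : Finset (Fin (2 * m + 4)), ((∑ e ∈ delta _ S, Y e : ℕ) : ZMod 2) =
      (if 0 ∈ S then 1 else 0) + (if t ∈ S then 1 else 0) :=
    fun S => ((hY S).2).trans (hx.sum_delta_zmod hst S)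
  -- Edges with index below `t` form one path between 0 and `t`, the others form the second. An arc
  -- bounded by one edge of each contains `t` but not 0, so its cut is odd; two edges of the same
  -- path bound an arc with neither end.
  have hodd : ∀ p q : Fin (2 * m + 4), p < t → t ≤ q →
      Odd (Y (cycleEdge m p) + Y (cycleEdge m q)) := by
    intro p q hp hq
    have h := hpar (Finset.Ioc p q)
    rw [sum_delta_arc m Y (hp.trans_le hq)] at h
    rw [if_neg (by simp), if_pos (by simp [hp, hq])] at h
    rw [← Nat.not_even_iff_odd, ← natCast_zmod_two_eq_zero_iff, h]
    decide
  have hcut : ∀ p q : Fin (2 * m + 4), p < q → ¬ (p < t ∧ t ≤ q) →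
      2 ≤ Y (cycleEdge m p) + Y (cycleEdge m q) := by
    intro p q hpq h
    rw [← sum_delta_arc m Y hpq]
    have h2 := hfeas.even_cut (Finset.Ioc p q) ⟨q, by simp [hpq]⟩
      (fun hu => by simpa using (Finset.ext_iff.1 hu 0).2 (Finset.mem_univ _)) (by
        rw [← natCast_zmod_two_eq_zero_iff, card_inter_pair_zmod _ hst, if_neg (by simp),
          if_neg (by simpa using h), add_zero])
    exact_mod_cast h2
  have key := three_mul_le_of_odd_cross (A := Finset.Iio t) (B := Finset.Ici t)
    (Y := fun i => Y (cycleEdge m i)) (k := m + 2) (by rw [Fin.card_Iio, ht])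
    (by rw [Fin.card_Ici, ht]; omega) (by omega)
    (fun i hi j hj => hodd i j (Finset.mem_Iio.1 hi) (Finset.mem_Ici.1 hj))
    (fun i hi j hj hij => by
      rw [Finset.mem_Iio] at hi hj
      rcases lt_or_gt_of_ne hij with h | h
      · exact hcut i j h fun h' => absurd h'.2 (not_le.2 hj)
      · rw [add_comm]
        exact hcut j i h fun h' => absurd h'.2 (not_le.2 hi))
    (fun i hi j hj hij => by
      rw [Finset.mem_Ici] at hi hj
      rcases lt_or_gt_of_ne hij with h | h
      · exact hcut i j h fun h' => absurd h'.1 (not_lt.2 hi)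
      · rw [add_comm]
        exact hcut j i h fun h' => absurd h'.1 (not_lt.2 hj))
  have hsum : ∑ i ∈ Finset.Iio t, Y (cycleEdge m i) + ∑ i ∈ Finset.Ici t, Y (cycleEdge m i) =
      ∑ e, Y e := by
    rw [← (cycleEdge_bijective m).sum_comp, ← Finset.sum_union]
    · congr 1
      ext i
      simp [lt_or_ge]
    · rw [Finset.disjoint_left]
      intro i hi hi'
      exact absurd (Finset.mem_Ici.1 hi') (not_le.2 (Finset.mem_Iio.1 hi))
  rw [hsum] at key
  rw [← hcost, ← hYc, cost_eq_sum]
  have keyR : (3 : ℝ) * (m + 2) ≤ ∑ e, (Y e : ℝ) + 2 := by exact_mod_cast key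
  simp only [one_mul]
  linarith

end Cycle

end PathTSP

/-- The first part also records that both optimal integral values are attained minima; the last
two parts say, with unit edge costs, that neither bound can be improved by a constant factor. -/
theorem mainTheorem3 :
    (∀ (V : Type*) [Fintype V] [DecidableEq V] (H : SimpleGraph V) (c' : H.edgeSet → ℝ) (s t : V),
      H.Connected → (∀ e, 0 ≤ c' e) → s ≠ t →
        IsLeast (PathTSP.intCosts1 c' s t) (PathTSP.optInt1 c' s t) ∧
        IsLeast (PathTSP.intCosts4 c' s t) (PathTSP.optInt4 c' s t) ∧
        PathTSP.optInt4 c' s t ≤ PathTSP.optInt1 c' s t ∧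
        PathTSP.optInt1 c' s t ≤ 3 / 2 * PathTSP.optInt4 c' s t) ∧
    (∀ n : ℕ, 2 ≤ n → ∃ (H : SimpleGraph (Fin n)) (s t : Fin n), H.Connected ∧ s ≠ t ∧
      0 < PathTSP.optInt4 (fun _ : H.edgeSet => (1 : ℝ)) s t ∧
      PathTSP.optInt4 (fun _ : H.edgeSet => (1 : ℝ)) s t =
        PathTSP.optInt1 (fun _ : H.edgeSet => (1 : ℝ)) s t) ∧
    (∀ ε : ℝ, 0 < ε → ∃ (n : ℕ) (H : SimpleGraph (Fin n)) (s t : Fin n), H.Connected ∧ s ≠ t ∧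
      0 < PathTSP.optInt4 (fun _ : H.edgeSet => (1 : ℝ)) s t ∧
      (3 / 2 - ε) * PathTSP.optInt4 (fun _ : H.edgeSet => (1 : ℝ)) s t <
        PathTSP.optInt1 (fun _ : H.edgeSet => (1 : ℝ)) s t) := by
  refine ⟨?_, ?_, ?_⟩
  · intro V _ _ H c' s t hH hc hst
    exact ⟨PathTSP.isLeast_optInt1 hH hc hst, PathTSP.isLeast_optInt4 hH hc s t,
      PathTSP.optInt4_le_optInt1 hH hc hst, PathTSP.optInt1_le hH hc hst⟩
  · intro n hn
    have : Nonempty (Fin n) := ⟨⟨0, by omega⟩⟩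
    have hst : (⟨0, by omega⟩ : Fin n) ≠ ⟨1, by omega⟩ := by simp
    exact ⟨⊤, ⟨0, by omega⟩, ⟨1, by omega⟩, SimpleGraph.connected_top, hst,
      PathTSP.optInt_top_eq hst⟩
  · intro ε hε
    obtain ⟨m, hm⟩ := exists_nat_gt (1 / ε)
    let t : Fin (2 * m + 4) := ⟨m + 2, by omega⟩
    have hst : (0 : Fin (2 * m + 4)) ≠ t := by simp [t, Fin.ext_iff]
    have h1 := PathTSP.card_sub_one_le_optInt4
      (SimpleGraph.cycleGraph_connected (n := 2 * m + 3)) 0 t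
    have h2 := PathTSP.optInt4_cycleGraph_le m 0 t
    have h3 := PathTSP.le_optInt1_cycleGraph m (t := t) rfl
    have hm0 : (0 : ℝ) ≤ m := Nat.cast_nonneg m
    have h4 : 1 < ε * m := by
      rwa [div_lt_iff₀' hε] at hm
    rw [Fintype.card_fin] at h1
    push_cast at h1
    refine ⟨2 * m + 4, SimpleGraph.cycleGraph (2 * m + 4), 0, t,
      SimpleGraph.cycleGraph_connected, hst, by linarith, lt_of_lt_of_le ?_ h3⟩
    -- For a nonnegative factor it suffices that `(3/2 - ε)(2m + 4) < 3(m + 2) - 2`, that is `ε(m +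
    -- 2) > 1`. A nonpositive factor makes the left side nonpositive.
    rcases le_total 0 (3 / 2 - ε) with h | h
    · have := mul_le_mul_of_nonneg_left h2 h
      nlinarith
    · have := mul_nonpos_of_nonpos_of_nonneg h (by linarith : (0 : ℝ) ≤ PathTSP.optInt4
        (fun _ : (SimpleGraph.cycleGraph (2 * m + 4)).edgeSet => (1 : ℝ)) 0 t)
      linarith
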